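/- Let $\Lambda\ge 0$ and $a,k\in\mathbb{R}$, and put $\sigma=\Lambda a^2/3$, $\Xi=1+\sigma$, $\Delta_\vartheta=1+\sigma\cos^2\vartheta$. Let $x(\vartheta)=\int_0^\vartheta \Delta_t^{-1/2}\,dt$ for $0\le\vartheta\le\pi$, let $I=(0,x(\pi))$, and let $\vartheta(x)$, $x\in I$, be the inverse function, which maps $I$ onto $(0,\pi)$. Consider the formal differential operator $$\mathcal{U}_u=\begin{pmatrix}0&\frac{d}{dx}-q(x)\\-\frac{d}{dx}-q(x)&0\end{pmatrix},\qquad q(x)=\frac{\Xi\,(k+\frac12)}{\sqrt{\Delta_{\vartheta(x)}}\,\sin\vartheta(x)},$$ and the minimal operator $A_u^{min}\Phi=\mathcal{U}_u\Phi$ with domain $C_0^\infty(I)^2$ in the Hilbert space $L^2(I,dx)^2$ of pairs of complex-valued functions. The operator $A_u^{min}$ is densely defined and closable. Its closure $A_u$ is self-adjoint if and only if $k\in\mathbb{R}\setminus(-1,0)$; in particular, $A_u$ is self-adjoint for every $k\in\mathbb{Z}$. Moreover, if $k\in\mathbb{R}\setminus(-1,0)$, then $\mathcal{U}_u$ is in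 the limit point case at both endpoints of $I$, and if $k\in(-1,0)$, then $\mathcal{U}_u$ is in the limit circle case at both endpoints. Here $\mathcal{U}_u$ is in the limit circle case at an endpoint if for every $z\in\mathbb{C}$ all solutions of $(\mathcal{U}_u-z)\Phi=0$ on $I$ are square integrable near that endpoint, and in the limit point case if for every $z\in\mathbb{C}$ at least one solution is not square integrable near that endpoint. -/

import Mathlib

open MeasureTheory Set
open scoped Distributions

noncomputable section

namespace KerrDeSitter

/-- `σ = Λ a² / 3`. -/
def sigma (Λ a : ℝ) : ℝ := Λ * a ^ 2 / 3

/-- `Ξ = 1 + Λ a² / 3`. -/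
def Xi (Λ a : ℝ) : ℝ := 1 + sigma Λ a

/-- `Δ_ϑ = 1 + (Λ a² / 3) cos² ϑ`. -/
def Delta (Λ a ϑ : ℝ) : ℝ := 1 + sigma Λ a * Real.cos ϑ ^ 2

/-- The coordinate `x(ϑ) = ∫₀^ϑ dt / √Δ_t`, i.e. `dx/dϑ = 1/√Δ_ϑ` with `x(0) = 0`. -/
def xCoord (Λ a ϑ : ℝ) : ℝ := ∫ t in (0 : ℝ)..ϑ, 1 / √(Delta Λ a t)

/-- The right endpoint `x(π)` of the interval `I`. -/
def xEnd (Λ a : ℝ) : ℝ := xCoord Λ a Real.pi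

/-- The open interval `I = (0, x(π))`. -/
def I (Λ a : ℝ) : TopologicalSpace.Opens ℝ := ⟨Ioo 0 (xEnd Λ a), isOpen_Ioo⟩

/-- The inverse coordinate transformation `ϑ(x)`, mapping `I` onto `(0, π)`; its values outside
`I` are irrelevant. -/
def theta (Λ a x : ℝ) : ℝ := Function.invFunOn (xCoord Λ a) (Ioo 0 Real.pi) x

/-- The coefficient `Ξ (k + 1/2) / (√Δ_{ϑ(x)} sin ϑ(x))`. -/
def q (Λ a k x : ℝ) : ℝ :=
  Xi Λ a * (k + 1 / 2) / (√(Delta Λ a (theta Λ a x)) * Real.sin (theta Λ a x))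

/-- The formal differential operator
`𝒰_u (Φ₁, Φ₂) = (Φ₂' - q Φ₂, -Φ₁' - q Φ₁)`. -/
def formalU (Λ a k : ℝ) (Φ : (ℝ → ℂ) × (ℝ → ℂ)) : (ℝ → ℂ) × (ℝ → ℂ) :=
  (fun x => deriv Φ.2 x - (q Λ a k x : ℂ) * Φ.2 x,
    fun x => -deriv Φ.1 x - (q Λ a k x : ℂ) * Φ.1 x)

/-! ### The coordinate transformation -/

theorem sigma_nonneg {Λ : ℝ} (hΛ : 0 ≤ Λ) (a : ℝ) : 0 ≤ sigma Λ a := by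
  unfold sigma; positivity

theorem Delta_pos {Λ : ℝ} (hΛ : 0 ≤ Λ) (a ϑ : ℝ) : 0 < Delta Λ a ϑ := by
  have := sigma_nonneg hΛ a
  unfold Delta; positivity

theorem continuous_Delta (Λ a : ℝ) : Continuous (Delta Λ a) := by
  unfold Delta; fun_prop

theorem continuous_density {Λ : ℝ} (hΛ : 0 ≤ Λ) (a : ℝ) :
    Continuous fun t => 1 / √(Delta Λ a t) :=
  continuous_const.div (continuous_Delta Λ a).sqrt
    fun t => (Real.sqrt_pos.2 (Delta_pos hΛ a t)).ne'

theorem hasDerivAt_xCoord {Λ : ℝ} (hΛ : 0 ≤ Λ) (a ϑ : ℝ) :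
    HasDerivAt (xCoord Λ a) (1 / √(Delta Λ a ϑ)) ϑ :=
  intervalIntegral.integral_hasDerivAt_right ((continuous_density hΛ a).intervalIntegrable _ _)
    ((continuous_density hΛ a).stronglyMeasurableAtFilter _ _) (continuous_density hΛ a).continuousAt

theorem continuous_xCoord {Λ : ℝ} (hΛ : 0 ≤ Λ) (a : ℝ) : Continuous (xCoord Λ a) :=
  continuous_iff_continuousAt.2 fun ϑ => (hasDerivAt_xCoord hΛ a ϑ).continuousAt

theorem strictMono_xCoord {Λ : ℝ} (hΛ : 0 ≤ Λ) (a : ℝ) : StrictMono (xCoord Λ a) :=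
  strictMono_of_deriv_pos fun ϑ => by
    rw [(hasDerivAt_xCoord hΛ a ϑ).deriv]
    exact one_div_pos.2 (Real.sqrt_pos.2 (Delta_pos hΛ a ϑ))

theorem xCoord_zero (Λ a : ℝ) : xCoord Λ a 0 = 0 := by simp [xCoord]

theorem image_xCoord {Λ : ℝ} (hΛ : 0 ≤ Λ) (a : ℝ) :
    xCoord Λ a '' Ioo 0 Real.pi = I Λ a := by
  apply Subset.antisymm
  · rintro _ ⟨ϑ, hϑ, rfl⟩
    refine ⟨?_, strictMono_xCoord hΛ a hϑ.2⟩
    rw [← xCoord_zero Λ a]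
    exact strictMono_xCoord hΛ a hϑ.1
  · have h := intermediate_value_Ioo Real.pi_pos.le (continuous_xCoord hΛ a).continuousOn
    rwa [xCoord_zero] at h

theorem theta_mem {Λ : ℝ} (hΛ : 0 ≤ Λ) (a : ℝ) {x : ℝ} (hx : x ∈ I Λ a) :
    theta Λ a x ∈ Ioo 0 Real.pi :=
  Function.invFunOn_mem (by rw [← SetLike.mem_coe, ← image_xCoord hΛ a] at hx; exact hx)

theorem xCoord_theta {Λ : ℝ} (hΛ : 0 ≤ Λ) (a : ℝ) {x : ℝ} (hx : x ∈ I Λ a) :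
    xCoord Λ a (theta Λ a x) = x :=
  Function.invFunOn_eq (by rw [← SetLike.mem_coe, ← image_xCoord hΛ a] at hx; exact hx)

theorem theta_xCoord {Λ : ℝ} (hΛ : 0 ≤ Λ) (a : ℝ) {ϑ : ℝ} (hϑ : ϑ ∈ Ioo 0 Real.pi) :
    theta Λ a (xCoord Λ a ϑ) = ϑ :=
  (strictMono_xCoord hΛ a).injective
    (Function.invFunOn_eq (f := xCoord Λ a) (b := xCoord Λ a ϑ) ⟨ϑ, hϑ, rfl⟩)

theorem continuousOn_theta {Λ : ℝ} (hΛ : 0 ≤ Λ) (a : ℝ) :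
    ContinuousOn (theta Λ a) (I Λ a) := by
  intro x hx
  refine ContinuousAt.continuousWithinAt ?_
  refine StrictMonoOn.continuousAt_of_image_mem_nhds (s := I Λ a) ?_ ((I Λ a).2.mem_nhds hx) ?_
  · intro x hx y hy hxy
    rw [← (strictMono_xCoord hΛ a).lt_iff_lt, xCoord_theta hΛ a hx, xCoord_theta hΛ a hy]
    exact hxy
  · refine Filter.mem_of_superset (isOpen_Ioo.mem_nhds (theta_mem hΛ a hx)) ?_
    intro ϑ hϑ
    refine ⟨xCoord Λ a ϑ, ?_, theta_xCoord hΛ a hϑ⟩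
    rw [← image_xCoord hΛ a]
    exact ⟨ϑ, hϑ, rfl⟩

theorem continuousOn_q {Λ : ℝ} (hΛ : 0 ≤ Λ) (a k : ℝ) :
    ContinuousOn (q Λ a k) (I Λ a) := by
  have h := continuousOn_theta hΛ a
  refine continuousOn_const.div
    (((continuous_Delta Λ a).sqrt.comp_continuousOn h).mul
      (Real.continuous_sin.comp_continuousOn h)) fun x hx => ?_
  have hm := theta_mem hΛ a hx
  exact mul_ne_zero (Real.sqrt_pos.2 (Delta_pos hΛ a _)).ne'
    (Real.sin_pos_of_pos_of_lt_pi hm.1 hm.2).ne'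

/-! ### The minimal operator -/

/-- Lebesgue measure on `I`. -/
abbrev mu (Λ a : ℝ) : Measure ℝ := volume.restrict (I Λ a : Set ℝ)

/-- The Hilbert space `L²(I, dx)²` of pairs, with inner product `∫_I (Φ₁ Ψ₁^* + Φ₂ Ψ₂^*) dx`. -/
abbrev H (Λ a : ℝ) : Type := WithLp 2 (Lp ℂ 2 (mu Λ a) × Lp ℂ 2 (mu Λ a))

/-- Pairs of test functions, `C₀^∞(I)²`. -/
abbrev TestPair (Λ a : ℝ) : Type := 𝓓(I Λ a, ℂ) × 𝓓(I Λ a, ℂ)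

theorem memLp_test {Λ a : ℝ} (φ : 𝓓(I Λ a, ℂ)) : MemLp φ 2 (mu Λ a) :=
  φ.continuous.memLp_of_hasCompactSupport φ.hasCompactSupport

theorem memLp_deriv_test {Λ a : ℝ} (φ : 𝓓(I Λ a, ℂ)) : MemLp (deriv φ) 2 (mu Λ a) :=
  (φ.contDiff.continuous_deriv (by simp)).memLp_of_hasCompactSupport φ.hasCompactSupport.deriv

theorem memLp_q_mul_test {Λ : ℝ} (hΛ : 0 ≤ Λ) (a k : ℝ) (φ : 𝓓(I Λ a, ℂ)) :
    MemLp (fun x => (q Λ a k x : ℂ) * φ x) 2 (mu Λ a) := by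
  have hs : HasCompactSupport fun x => (q Λ a k x : ℂ) * φ x := φ.hasCompactSupport.mul_left
  refine Continuous.memLp_of_hasCompactSupport ?_ hs
  refine continuous_of_tsupport fun x hx => ?_
  have hx' : x ∈ (I Λ a : Set ℝ) :=
    φ.tsupport_subset (closure_mono (Function.support_mul_subset_right _ _) hx)
  have hq := (continuousOn_q hΛ a k).continuousAt ((I Λ a).2.mem_nhds hx')
  exact (Complex.continuous_ofReal.continuousAt.comp hq).mul φ.continuous.continuousAt

theorem memLp_formalU_fst {Λ : ℝ} (hΛ : 0 ≤ Λ) (a k : ℝ) (φ : TestPair Λ a) :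
    MemLp (formalU Λ a k (φ.1, φ.2)).1 2 (mu Λ a) :=
  (memLp_deriv_test φ.2).sub (memLp_q_mul_test hΛ a k φ.2)

theorem memLp_formalU_snd {Λ : ℝ} (hΛ : 0 ≤ Λ) (a k : ℝ) (φ : TestPair Λ a) :
    MemLp (formalU Λ a k (φ.1, φ.2)).2 2 (mu Λ a) :=
  (memLp_deriv_test φ.1).neg.sub (memLp_q_mul_test hΛ a k φ.1)

theorem differentiable_test {Λ a : ℝ} (φ : 𝓓(I Λ a, ℂ)) : Differentiable ℝ φ :=
  φ.contDiff.differentiable (by simp)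

/-- The inclusion `C₀^∞(I)² → L²(I, dx)²`. -/
def incl (Λ a : ℝ) : TestPair Λ a →ₗ[ℂ] H Λ a where
  toFun φ := WithLp.toLp 2 ((memLp_test φ.1).toLp φ.1, (memLp_test φ.2).toLp φ.2)
  map_add' _ _ := rfl
  map_smul' _ _ := rfl

theorem incl_injective (Λ a : ℝ) : Function.Injective (incl Λ a) := by
  have key : ∀ φ ψ : 𝓓(I Λ a, ℂ), (memLp_test φ).toLp φ = (memLp_test ψ).toLp ψ → φ = ψ := by
    intro φ ψ h
    rw [MemLp.toLp_eq_toLp_iff] at h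
    have h' := Measure.eqOn_open_of_ae_eq h (I Λ a).2 φ.continuous.continuousOn
      ψ.continuous.continuousOn
    ext x
    by_cases hx : x ∈ (I Λ a : Set ℝ)
    · exact h' hx
    · rw [image_eq_zero_of_notMem_tsupport fun h => hx (φ.tsupport_subset h),
        image_eq_zero_of_notMem_tsupport fun h => hx (ψ.tsupport_subset h)]
  intro φ ψ h
  have h0 := congrArg WithLp.ofLp h
  exact Prod.ext (key _ _ (congrArg Prod.fst h0)) (key _ _ (congrArg Prod.snd h0))

/-- The map `C₀^∞(I)² → L²(I, dx)²`, `Φ ↦ 𝒰_u Φ`. -/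
def applyU {Λ : ℝ} (hΛ : 0 ≤ Λ) (a k : ℝ) : TestPair Λ a →ₗ[ℂ] H Λ a where
  toFun φ := WithLp.toLp 2
    ((memLp_formalU_fst hΛ a k φ).toLp _, (memLp_formalU_snd hΛ a k φ).toLp _)
  map_add' φ ψ := by
    refine congrArg (WithLp.toLp 2) (Prod.ext ?_ ?_)
    · refine Eq.trans (MemLp.toLp_congr (memLp_formalU_fst hΛ a k (φ + ψ)) ((memLp_formalU_fst hΛ a k φ).add
        (memLp_formalU_fst hΛ a k ψ)) (Filter.Eventually.of_forall fun x => ?_))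
        (MemLp.toLp_add (memLp_formalU_fst hΛ a k φ) (memLp_formalU_fst hΛ a k ψ))
      simp only [formalU, Prod.snd_add, FunLike.coe_add, Pi.add_apply]
      rw [deriv_add (differentiable_test _ x) (differentiable_test _ x)]
      ring
    · refine Eq.trans (MemLp.toLp_congr (memLp_formalU_snd hΛ a k (φ + ψ)) ((memLp_formalU_snd hΛ a k φ).add
        (memLp_formalU_snd hΛ a k ψ)) (Filter.Eventually.of_forall fun x => ?_))
        (MemLp.toLp_add (memLp_formalU_snd hΛ a k φ) (memLp_formalU_snd hΛ a k ψ))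
      simp only [formalU, Prod.fst_add, FunLike.coe_add, Pi.add_apply]
      rw [deriv_add (differentiable_test _ x) (differentiable_test _ x)]
      ring
  map_smul' c φ := by
    refine congrArg (WithLp.toLp 2) (Prod.ext ?_ ?_)
    · refine Eq.trans (MemLp.toLp_congr (memLp_formalU_fst hΛ a k (c • φ)) ((memLp_formalU_fst hΛ a k φ).const_smul c)
        (Filter.Eventually.of_forall fun x => ?_)) (MemLp.toLp_const_smul c (memLp_formalU_fst hΛ a k φ))
      simp only [formalU, Prod.smul_snd, FunLike.coe_smul, Pi.smul_apply, smul_eq_mul]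
      rw [deriv_const_smul c (differentiable_test _ x), smul_eq_mul]
      ring
    · refine Eq.trans (MemLp.toLp_congr (memLp_formalU_snd hΛ a k (c • φ)) ((memLp_formalU_snd hΛ a k φ).const_smul c)
        (Filter.Eventually.of_forall fun x => ?_)) (MemLp.toLp_const_smul c (memLp_formalU_snd hΛ a k φ))
      simp only [formalU, Prod.smul_fst, FunLike.coe_smul, Pi.smul_apply, smul_eq_mul]
      rw [deriv_const_smul c (differentiable_test _ x), smul_eq_mul]
      ring

/-- The minimal operator: domain `C₀^∞(I)²` (as a subspace of `L²(I, dx)²`), acting as `𝒰_u`. -/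
def minOp {Λ : ℝ} (hΛ : 0 ≤ Λ) (a k : ℝ) : H Λ a →ₗ.[ℂ] H Λ a where
  domain := LinearMap.range (incl Λ a)
  toFun := applyU hΛ a k ∘ₗ
    (LinearEquiv.ofInjective (incl Λ a) (incl_injective Λ a)).symm.toLinearMap

theorem minOp_apply {Λ : ℝ} (hΛ : 0 ≤ Λ) (a k : ℝ) (φ : TestPair Λ a) :
    minOp hΛ a k ⟨incl Λ a φ, φ, rfl⟩ = applyU hΛ a k φ :=
   congrArg (applyU hΛ a k)
    ((LinearEquiv.ofInjective (incl Λ a) (incl_injective Λ a)).symm_apply_apply φ)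

/-- The closure `A_u` of the minimal operator. -/
def Au {Λ : ℝ} (hΛ : 0 ≤ Λ) (a k : ℝ) : H Λ a →ₗ.[ℂ] H Λ a := (minOp hΛ a k).closure

/-! ### Limit point and limit circle -/

/-- `Φ` is a solution of `(𝒰_u - z) Φ = 0` on `I`. -/
def IsSolution (Λ a k : ℝ) (z : ℂ) (Φ : (ℝ → ℂ) × (ℝ → ℂ)) : Prop :=
  DifferentiableOn ℝ Φ.1 (I Λ a) ∧ DifferentiableOn ℝ Φ.2 (I Λ a) ∧
    ∀ x ∈ I Λ a, (formalU Λ a k Φ).1 x = z * Φ.1 x ∧ (formalU Λ a k Φ).2 x = z * Φ.2 x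

/-- `Φ` lies left in `L²(I, dx)²`: it is square integrable near the left endpoint `0`. -/
def LiesLeft (Λ a : ℝ) (Φ : (ℝ → ℂ) × (ℝ → ℂ)) : Prop :=
  ∃ c ∈ I Λ a, MemLp Φ.1 2 (volume.restrict (Ioo 0 c)) ∧ MemLp Φ.2 2 (volume.restrict (Ioo 0 c))

/-- `Φ` lies right in `L²(I, dx)²`: it is square integrable near the right endpoint `x(π)`. -/
def LiesRight (Λ a : ℝ) (Φ : (ℝ → ℂ) × (ℝ → ℂ)) : Prop :=
  ∃ c ∈ I Λ a, MemLp Φ.1 2 (volume.restrict (Ioo c (xEnd Λ a))) ∧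
    MemLp Φ.2 2 (volume.restrict (Ioo c (xEnd Λ a)))

/-- Limit circle case at an endpoint, where `L` says that a function is square integrable near that
endpoint: for every `z ∈ ℂ` all solutions of `(𝒰_u - z) Φ = 0` are. -/
def IsLimitCircle (Λ a k : ℝ) (L : (ℝ → ℂ) × (ℝ → ℂ) → Prop) : Prop :=
  ∀ z : ℂ, ∀ Φ, IsSolution Λ a k z Φ → L Φ

/-- Limit point case at an endpoint, where `L` says that a function is square integrable near that
endpoint: for every `z ∈ ℂ` some solution of `(𝒰_u - z) Φ = 0` is not. -/
def IsLimitPoint (Λ a k : ℝ) (L : (ℝ → ℂ) × (ℝ → ℂ) → Prop) : Prop :=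
  ∀ z : ℂ, ∃ Φ, IsSolution Λ a k z Φ ∧ ¬ L Φ

end KerrDeSitter

end

/-! Put `κ = k + 1/2`. The function `weight κ = exp (κ ∫ qUnit)` is an integrating factor: a
solution of `(𝒰_u - z) Φ = 0` satisfies `(weight κ · Φ₁)' = -z · weight κ · Φ₂` and `(weight (-κ) ·
Φ₂)' = z · weight (-κ) · Φ₁`. An explicit primitive of `qUnit` shows that `weight κ` is comparable
to `x ^ κ` at `0`, and reflection of `I` replaces `κ` by `-κ`. Hence `weight κ` and `weight (-κ)`
are both square integrable on `I` exactly when `|κ| < 1/2`, that is, `k ∈ (-1, 0)`.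

For `|κ| < 1/2`, a Gronwall estimate bounds the weighted components near `0`, so all solutions are
square integrable there (`isLimitCircle_left`). Two explicit elements of the adjoint domain have a
nonzero boundary pairing, so the adjoint is not symmetric (`not_isSelfAdjoint`).

For `|κ| ≥ 1/2`, a solution that is square integrable near an endpoint has one component tending to
`0` and the other bounded (`tendsto_mul_left`). Boundary terms therefore vanish. Applied to the
constant Wronskian this gives the limit point case. Applied to the Lagrange identity for `Im (Φ₂
Φ₁^*)` it excludes nonzero square integrable solutions at non-real `z`. Eigenvectors of the adjoint
are classical solutions by the du Bois-Reymond lemma (`exists_isSolution_of_adjPair`), so `± i` are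
not eigenvalues of the adjoint, and the basic criterion `LinearPMap.isSelfAdjoint_closure` applies.
The right endpoint always follows from the left one by reflection. -/

/-! ### Symmetric operators and the basic criterion for essential self-adjointness. -/

namespace LinearPMap

open scoped ComplexConjugate

variable {E : Type*} [NormedAddCommGroup E] [InnerProductSpace ℂ E]

/-- `(f, g)` lies in the graph of the adjoint of `T`. -/
def AdjPair (T : E →ₗ.[ℂ] E) (f g : E) : Prop :=
  ∀ x : T.domain, inner ℂ g (x : E) = inner ℂ f (T x)

/-- For fixed `f` and `g` the defining identity is a closed condition on the pair `(x, T x)`, so it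
passes to the closure of the graph. -/
theorem AdjPair.closure {T : E →ₗ.[ℂ] E} (hT : T.IsClosable) {f g : E} (h : AdjPair T f g) :
    AdjPair T.closure f g := by
  intro x
  have hx : ((x : E), T.closure x) ∈ _root_.closure (T.graph : Set (E × E)) := by
    have := T.closure.mem_graph x
    rw [← hT.graph_closure_eq_closure_graph] at this
    exact this
  have hc : _root_.IsClosed {p : E × E | inner ℂ g p.1 = inner ℂ f p.2} :=
    isClosed_eq (by fun_prop) (by fun_prop)
  refine closure_minimal ?_ hc hx
  rintro p hp
  obtain ⟨y, hy1, hy2⟩ := (mem_graph_iff T).1 hp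
  rw [mem_ofPred_eq, ← hy1, ← hy2]
  exact h y

/-- Symmetry makes `⟨A x, x⟩` real, so the cross term `2 Re (i ⟨A x, x⟩)` vanishes. -/
theorem norm_sq_add_I_smul {A : E →ₗ.[ℂ] E} (hs : A.IsFormalAdjoint A) (x : A.domain) :
    ‖A x + Complex.I • (x : E)‖ ^ 2 = ‖A x‖ ^ 2 + ‖(x : E)‖ ^ 2 := by
  have h1 := hs x x
  rw [norm_add_sq (𝕜 := ℂ), inner_smul_right, norm_smul]
  have h2 : (inner ℂ (A x) (x : E)).im = 0 := by
    have h3 := inner_conj_symm (𝕜 := ℂ) (x : E) (A x)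
    rw [← h1] at h3
    exact Complex.conj_eq_iff_im.1 h3
  simp [h2]

variable [CompleteSpace E]

theorem isClosable_of_symmetric {T : E →ₗ.[ℂ] E} (hd : Dense (T.domain : Set E))
    (hs : T.IsFormalAdjoint T) : T.IsClosable :=
  (adjoint_isClosed hd).isClosable.leIsClosable (hs.le_adjoint hd)

/-- `AdjPair.closure` is applied twice, extending one argument of the symmetry relation at a time.
-/
theorem closure_symmetric {T : E →ₗ.[ℂ] E} (hd : Dense (T.domain : Set E))
    (hs : T.IsFormalAdjoint T) : T.closure.IsFormalAdjoint T.closure := by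
  have hc := isClosable_of_symmetric hd hs
  have h1 : ∀ y : T.domain, AdjPair T.closure (y : E) (T y) := fun y =>
    AdjPair.closure hc fun x => hs y x
  intro x
  refine AdjPair.closure hc (f := (x : E)) (g := T.closure x) fun y => ?_
  rw [← inner_conj_symm, ← inner_conj_symm (x : E), h1 y x]

/-- If the closure of `T` is self-adjoint, then the adjoint of `T` is symmetric. -/
theorem AdjPair.inner_eq_of_isSelfAdjoint {T : E →ₗ.[ℂ] E} (hc : T.IsClosable)
    (hsa : IsSelfAdjoint T.closure) {f g h l : E} (hfg : AdjPair T f g) (hhl : AdjPair T h l) :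
    inner ℂ g h = inner ℂ f l := by
  have h1 := hhl.closure hc
  have hmem : h ∈ T.closure.adjoint.domain := mem_adjoint_domain_of_exists h ⟨l, h1⟩
  have hval : T.closure.adjoint ⟨h, hmem⟩ = l := adjoint_apply_eq hsa.dense_domain _ h1
  have hgr : (h, l) ∈ T.closure.adjoint.graph := by
    rw [mem_graph_iff]; exact ⟨⟨h, hmem⟩, rfl, hval⟩
  rw [isSelfAdjoint_def.1 hsa, mem_graph_iff] at hgr
  obtain ⟨y, hy1, hy2⟩ := hgr
  have := hfg.closure hc y
  simp only at hy1 hy2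
  rwa [hy1, hy2] at this

/-- The norm of `(A + i) x` controls both `‖A x‖` and `‖x‖`. Convergence of `(A + i) xₙ` thus makes
`xₙ` and `A xₙ` Cauchy, and closedness of the graph identifies the limit. -/
theorem isClosed_range_add_I {A : E →ₗ.[ℂ] E} (hA : A.IsClosed) (hs : A.IsFormalAdjoint A) :
    _root_.IsClosed (LinearMap.range (A.toFun + Complex.I • A.domain.subtype) : Set E) := by
  have hbound : ∀ x : A.domain, ‖A x‖ ≤ ‖A x + Complex.I • (x : E)‖ ∧
      ‖(x : E)‖ ≤ ‖A x + Complex.I • (x : E)‖ := fun x => by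
    have h := norm_sq_add_I_smul hs x
    constructor <;> refine le_of_sq_le_sq ?_ (norm_nonneg _) <;>
      nlinarith [sq_nonneg ‖A x‖, sq_nonneg ‖(x : E)‖]
  rw [← isSeqClosed_iff_isClosed]
  intro y b hy hb
  choose x hx using hy
  have hx' : ∀ n, A (x n) + Complex.I • (x n : E) = y n := hx
  have hcau := hb.cauchySeq
  have hdiff : ∀ n m, A (x n - x m) + Complex.I • ((x n - x m : A.domain) : E) = y n - y m := by
    intro n m
    rw [← hx', ← hx', map_sub, Submodule.coe_sub, smul_sub]; abel
  have hcx : CauchySeq fun n => (x n : E) := by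
    rw [Metric.cauchySeq_iff] at hcau ⊢
    intro ε hε
    obtain ⟨N, hN⟩ := hcau ε hε
    refine ⟨N, fun m hm n hn => lt_of_le_of_lt ?_ (hN m hm n hn)⟩
    rw [dist_eq_norm, dist_eq_norm, ← hdiff]
    exact (hbound (x m - x n)).2
  have hcA : CauchySeq fun n => A (x n) := by
    rw [Metric.cauchySeq_iff] at hcau ⊢
    intro ε hε
    obtain ⟨N, hN⟩ := hcau ε hε
    refine ⟨N, fun m hm n hn => lt_of_le_of_lt ?_ (hN m hm n hn)⟩
    rw [dist_eq_norm, dist_eq_norm, ← hdiff, ← map_sub]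
    exact (hbound (x m - x n)).1
  obtain ⟨u, hu⟩ := cauchySeq_tendsto_of_complete hcx
  obtain ⟨v, hv⟩ := cauchySeq_tendsto_of_complete hcA
  have hgr : (u, v) ∈ A.graph :=
    hA.mem_of_tendsto (hu.prodMk_nhds hv) (Filter.Eventually.of_forall fun n => A.mem_graph (x n))
  obtain ⟨w, hw1, hw2⟩ := (mem_graph_iff A).1 hgr
  refine ⟨w, ?_⟩
  change A w + Complex.I • (w : E) = b
  refine tendsto_nhds_unique ?_ hb
  simp only at hw1 hw2
  rw [hw1, hw2]
  exact (hv.add (hu.const_smul Complex.I)).congr fun n => hx' n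

/-- A densely defined symmetric operator whose adjoint does not have the eigenvalues `± i` is
essentially self-adjoint. -/
theorem isSelfAdjoint_closure {T : E →ₗ.[ℂ] E} (hd : Dense (T.domain : Set E))
    (hs : T.IsFormalAdjoint T) (hp : ∀ f, AdjPair T f (Complex.I • f) → f = 0)
    (hm : ∀ f, AdjPair T f (-Complex.I • f) → f = 0) : IsSelfAdjoint T.closure := by
  have hc := isClosable_of_symmetric hd hs
  have hcs := closure_symmetric hd hs
  have hdc : Dense (T.closure.domain : Set E) := hd.mono T.le_closure.1
  have hrestrict : ∀ f g, AdjPair T.closure f g → AdjPair T f g := fun f g h x => by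
    have h1 := h ⟨x, T.le_closure.1 x.2⟩
    rwa [← T.le_closure.2 (x := x) (y := ⟨x, T.le_closure.1 x.2⟩) rfl] at h1
  set A := T.closure with hA
  -- A vector orthogonal to the range of `A + i` is an eigenvector of the adjoint for `i`, hence
  -- zero; as the range is closed, it is everything.
  have hrange : LinearMap.range (A.toFun + Complex.I • A.domain.subtype) = ⊤ := by
    have hcl := isClosed_range_add_I hc.closure_isClosed hcs
    rw [← hcl.submodule_topologicalClosure_eq, Submodule.topologicalClosure_eq_top_iff,
      Submodule.eq_bot_iff]
    intro f hf
    refine hp f (hrestrict _ _ fun x => ?_)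
    rw [Submodule.mem_orthogonal'] at hf
    have h1 : inner ℂ f (A x + Complex.I • (x : E)) = 0 := hf _ ⟨x, rfl⟩
    rw [inner_add_right, inner_smul_right] at h1
    rw [inner_smul_left, Complex.conj_I]
    linear_combination -h1
  rw [isSelfAdjoint_def]
  refine le_antisymm ?_ (hcs.le_adjoint hdc)
  -- Surjectivity of `A + i` gives `x` with `(A + i) x = (A^* + i) y`. Then `y - x` is an
  -- eigenvector of the adjoint for `-i`, so `y = x`.
  have hkey : ∀ y : A.adjoint.domain, ∃ x : A.domain, (x : E) = y ∧ A x = A.adjoint y := by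
    intro y
    obtain ⟨x, hx⟩ : A.adjoint y + Complex.I • (y : E) ∈
      LinearMap.range (A.toFun + Complex.I • A.domain.subtype) := hrange ▸ Submodule.mem_top
    have hx' : A x + Complex.I • (x : E) = A.adjoint y + Complex.I • (y : E) := hx
    have h0 : (y : E) - x = 0 := by
      refine hm _ (hrestrict _ _ fun w => ?_)
      have e1 : inner ℂ (A.adjoint y) (w : E) = inner ℂ (y : E) (A w) :=
        adjoint_isFormalAdjoint hdc y w
      have e2 := hcs x w
      have e3 : -Complex.I • ((y : E) - x) = A.adjoint y - A x := by
        rw [neg_smul, smul_sub, neg_sub, sub_eq_sub_iff_add_eq_add, add_comm, hx', add_comm]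
      rw [e3, inner_sub_left, inner_sub_left, e1, e2]
    have h1 : (x : E) = y := (sub_eq_zero.1 h0).symm
    refine ⟨x, h1, ?_⟩
    rw [h1] at hx'
    exact add_right_cancel hx'
  refine ⟨fun y hy => ?_, fun y x hyx => ?_⟩
  · obtain ⟨x, hx, -⟩ := hkey ⟨y, hy⟩
    have h := x.2
    rwa [hx] at h
  · obtain ⟨x', hx', h2⟩ := hkey y
    rw [← h2]
    congr 1
    exact Subtype.ext (hx'.trans hyx)

end LinearPMap

/-! ### Existence for linear ODEs on an open interval. -/

section LinearODE

variable {E : Type*} [NormedAddCommGroup E] [NormedSpace ℝ E]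

theorem uIcc_subset_Ioo {a b x y : ℝ} (hx : x ∈ Ioo a b) (hy : y ∈ Ioo a b) :
    uIcc x y ⊆ Ioo a b := ordConnected_Ioo.uIcc_subset hx hy

theorem hasDerivAt_integral_of_continuousOn_Ioo [CompleteSpace E] {a b x₀ x : ℝ} {g : ℝ → E}
    (hg : ContinuousOn g (Ioo a b)) (hx₀ : x₀ ∈ Ioo a b) (hx : x ∈ Ioo a b) :
    HasDerivAt (fun y => ∫ t in x₀..y, g t) (g x) x :=
  intervalIntegral.integral_hasDerivAt_right
    ((hg.mono (uIcc_subset_Ioo hx₀ hx)).intervalIntegrable)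
    (hg.stronglyMeasurableAtFilter isOpen_Ioo x hx) (hg.continuousAt (isOpen_Ioo.mem_nhds hx))

/-- The terms of the Picard series of the linear equation `y' = A y`, `y x₀ = y₀`. -/
noncomputable def picardTerm (A : ℝ → E →L[ℝ] E) (x₀ : ℝ) (y₀ : E) : ℕ → ℝ → E
  | 0 => fun _ => y₀
  | n + 1 => fun x => ∫ t in x₀..x, A t (picardTerm A x₀ y₀ n t)

variable [CompleteSpace E] {A : ℝ → E →L[ℝ] E} {a b x₀ : ℝ} {y₀ : E}

theorem continuousOn_picardTerm (hA : ContinuousOn A (Ioo a b)) (hx₀ : x₀ ∈ Ioo a b) (n : ℕ) :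
    ContinuousOn (picardTerm A x₀ y₀ n) (Ioo a b) := by
  induction n with
  | zero => exact continuousOn_const
  | succ n ih => exact fun x hx => (hasDerivAt_integral_of_continuousOn_Ioo (hA.clm_apply ih)
      hx₀ hx).continuousAt.continuousWithinAt

theorem hasDerivAt_picardTerm_succ (hA : ContinuousOn A (Ioo a b)) (hx₀ : x₀ ∈ Ioo a b) (n : ℕ)
    {x : ℝ} (hx : x ∈ Ioo a b) :
    HasDerivAt (picardTerm A x₀ y₀ (n + 1)) (A x (picardTerm A x₀ y₀ n x)) x :=
  hasDerivAt_integral_of_continuousOn_Ioo (hA.clm_apply (continuousOn_picardTerm hA hx₀ n)) hx₀ hx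

omit [CompleteSpace E] in
-- Each integration raises the power of `|x - x₀|` by one, and the resulting divisors accumulate to
-- the factorial.
theorem norm_picardTerm_le {c d K : ℝ} (hK : 0 ≤ K) (hx₀ : x₀ ∈ Icc c d)
    (hAK : ∀ x ∈ Icc c d, ‖A x‖ ≤ K) (n : ℕ) {x : ℝ} (hx : x ∈ Icc c d) :
    ‖picardTerm A x₀ y₀ n x‖ ≤ (K * |x - x₀|) ^ n / n.factorial * ‖y₀‖ := by
  induction n generalizing x with
  | zero => simp [picardTerm]
  | succ n ih =>
    calc ‖picardTerm A x₀ y₀ (n + 1) x‖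
      _ ≤ ∫ t in uIoc x₀ x, K ^ (n + 1) * |t - x₀| ^ n / n.factorial * ‖y₀‖ := by
        rw [picardTerm, intervalIntegral.norm_intervalIntegral_eq]
        apply MeasureTheory.norm_integral_le_of_norm_le (Continuous.integrableOn_uIoc (by fun_prop))
        refine (ae_restrict_mem measurableSet_Ioc).mono fun t ht => ?_
        have ht' : t ∈ Icc c d := uIcc_subset_Icc hx₀ hx (uIoc_subset_uIcc ht)
        calc _ ≤ ‖A t‖ * ‖picardTerm A x₀ y₀ n t‖ := (A t).le_opNorm _
          _ ≤ K * ((K * |t - x₀|) ^ n / n.factorial * ‖y₀‖) := by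
            gcongr
            exacts [hAK t ht', ih ht']
          _ = _ := by rw [mul_pow]; ring
      _ ≤ _ := by
        apply le_of_abs_le
        rw [← intervalIntegral.abs_intervalIntegral_eq, intervalIntegral.integral_mul_const,
          intervalIntegral.integral_div, intervalIntegral.integral_const_mul, abs_mul, abs_div,
          abs_mul, intervalIntegral.abs_intervalIntegral_eq, integral_pow_abs_sub_uIoc, abs_div,
          abs_pow, abs_pow, abs_norm, abs_abs, mul_div, div_div, abs_of_nonneg hK, ← abs_mul,
          ← Nat.cast_succ, ← Nat.cast_mul, ← Nat.factorial_succ, Nat.abs_cast, ← mul_pow]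

/-- The Picard series of a linear equation converges locally uniformly on the whole interval. No
continuation argument is needed, and `A` may be unbounded at the endpoints. -/
theorem exists_hasDerivAt_linear (hA : ContinuousOn A (Ioo a b)) (hx₀ : x₀ ∈ Ioo a b) (y₀ : E) :
    ∃ y : ℝ → E, y x₀ = y₀ ∧ ∀ x ∈ Ioo a b, HasDerivAt y (A x (y x)) x := by
  refine ⟨fun x => ∑' n, picardTerm A x₀ y₀ n x, ?_, fun x hx => ?_⟩
  · refine (tsum_eq_single 0 ?_).trans rfl
    intro n hn
    obtain ⟨m, rfl⟩ := Nat.exists_eq_succ_of_ne_zero hn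
    simp [picardTerm]
  -- A compact subinterval with both `x₀` and `x` in its interior; `A` is bounded on it.
  · obtain ⟨c, hc1, hc2⟩ := exists_between (lt_min hx₀.1 hx.1)
    obtain ⟨d, hd1, hd2⟩ := exists_between (max_lt hx₀.2 hx.2)
    have hcx₀ : x₀ ∈ Ioo c d := ⟨hc2.trans_le (min_le_left _ _), (le_max_left _ _).trans_lt hd1⟩
    have hcx : x ∈ Ioo c d := ⟨hc2.trans_le (min_le_right _ _), (le_max_right _ _).trans_lt hd1⟩
    have hsub : Icc c d ⊆ Ioo a b := Icc_subset_Ioo hc1 hd2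
    obtain ⟨K', hK'⟩ := isCompact_Icc.exists_bound_of_continuousOn (hA.mono hsub)
    set K := max K' 0
    have hK0 : 0 ≤ K := le_max_right _ _
    have hK : ∀ x ∈ Icc c d, ‖A x‖ ≤ K := fun x hx => (hK' x hx).trans (le_max_left _ _)
    have hbd : ∀ n, ∀ t ∈ Icc c d,
        ‖picardTerm A x₀ y₀ n t‖ ≤ (K * (d - c)) ^ n / n.factorial * ‖y₀‖ := by
      intro n t ht
      refine (norm_picardTerm_le hK0 (Ioo_subset_Icc_self hcx₀) hK n ht).trans ?_
      gcongr
      rw [abs_le]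
      constructor <;> linarith [ht.1, ht.2, hcx₀.1, hcx₀.2]
    have hsum : Summable fun n : ℕ => (K * (d - c)) ^ n / n.factorial * ‖y₀‖ :=
      (Real.summable_pow_div_factorial _).mul_right _
    have hs : ∀ t ∈ Icc c d, Summable fun n => picardTerm A x₀ y₀ n t := fun t ht =>
      hsum.of_norm_bounded fun n => hbd n t ht
    -- Termwise differentiation of the series without its constant zeroth term: the derivative of
    -- term `n + 1` is `A` applied to term `n`.
    have hder := hasDerivAt_tsum_of_isPreconnected (g := fun n => picardTerm A x₀ y₀ (n + 1))
      (g' := fun n t => A t (picardTerm A x₀ y₀ n t)) (hsum.mul_left K) isOpen_Ioo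
      isPreconnected_Ioo
      (fun n t ht => hasDerivAt_picardTerm_succ hA hx₀ n (hsub (Ioo_subset_Icc_self ht)))
      (fun n t ht => ((A t).le_opNorm _).trans (mul_le_mul (hK t (Ioo_subset_Icc_self ht))
        (hbd n t (Ioo_subset_Icc_self ht)) (norm_nonneg _) hK0)) hcx₀
      ((summable_nat_add_iff 1).2 (hs x₀ (Ioo_subset_Icc_self hcx₀))) hcx
    rw [(A x).map_tsum (hs x (Ioo_subset_Icc_self hcx))]
    refine (hder.const_add y₀).congr_of_eventuallyEq ?_
    filter_upwards [isOpen_Ioo.mem_nhds hcx] with t ht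
    exact (hs t (Ioo_subset_Icc_self ht)).tsum_eq_zero_add

end LinearODE

/-! ### Weak derivatives and the du Bois-Reymond lemma. -/

section DuBoisReymond

open scoped ContDiff

theorem exists_Ioo_of_isCompact {a b x₀ : ℝ} {K : Set ℝ} (hK : IsCompact K) (hKs : K ⊆ Ioo a b)
    (hx₀ : x₀ ∈ Ioo a b) : ∃ c d, a < c ∧ d < b ∧ x₀ ∈ Ioo c d ∧ K ⊆ Ioo c d := by
  have hc : IsCompact (insert x₀ K) := hK.insert x₀
  have hs : insert x₀ K ⊆ Ioo a b := insert_subset hx₀ hKs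
  have hne : (insert x₀ K).Nonempty := insert_nonempty _ _
  obtain ⟨l, hl, hl'⟩ := hc.exists_isLeast hne
  obtain ⟨u, hu, hu'⟩ := hc.exists_isGreatest hne
  obtain ⟨c, hc1, hc2⟩ := exists_between (hs hl).1
  obtain ⟨d, hd1, hd2⟩ := exists_between (hs hu).2
  have : insert x₀ K ⊆ Ioo c d := fun x hx => ⟨hc2.trans_le (hl' hx), (hu' hx).trans_lt hd1⟩
  exact ⟨c, d, hc1, hd2, this (mem_insert _ _), (subset_insert _ _).trans this⟩

theorem setIntegral_Ioo_eq_intervalIntegral {E : Type*} [NormedAddCommGroup E] [NormedSpace ℝ E]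
    {a b c d : ℝ} (hac : a < c) (hcd : c ≤ d) (hdb : d < b) {f : ℝ → E}
    (hf : ∀ x ∉ Ioo c d, f x = 0) : ∫ x in Ioo a b, f x = ∫ x in c..d, f x := by
  rw [intervalIntegral.integral_of_le hcd]
  refine setIntegral_eq_of_subset_of_forall_sdiff_eq_zero measurableSet_Ioo
    (fun x hx => ⟨hac.trans hx.1, hx.2.trans_lt hdb⟩) fun x hx => hf x fun h => hx.2 ?_
  exact ⟨h.1, h.2.le⟩

/-- Since `g` is merely integrable, its primitive is only absolutely continuous. Integration by
parts is used in that class, and the derivative of the primitive is identified almost everywhere. -/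
theorem integral_deriv_mul_integral {c d x₀ : ℝ} {g φ : ℝ → ℝ}
    (hg : IntervalIntegrable g volume c d) (hx₀ : x₀ ∈ uIcc c d) (hφ : ContDiff ℝ 1 φ)
    (hc : φ c = 0) (hd : φ d = 0) :
    ∫ x in c..d, deriv φ x * ∫ t in x₀..x, g t = -∫ x in c..d, φ x * g x := by
  have h := AbsolutelyContinuousOnInterval.integral_mul_deriv_eq_deriv_mul
    (hg.absolutelyContinuousOnInterval_intervalIntegral hx₀)
    hφ.contDiffOn.absolutelyContinuousOnInterval (a := c) (b := d)
  rw [hc, hd, mul_zero, mul_zero, sub_zero, zero_sub] at h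
  rw [← intervalIntegral.integral_congr (g := fun x => deriv φ x * ∫ t in x₀..x, g t)
    (fun x _ => mul_comm _ _), h]
  congr 1
  refine intervalIntegral.integral_congr_ae ?_
  filter_upwards [hg.ae_hasDerivAt_integral] with x hx hxm
  rw [(hx (uIoc_subset_uIcc hxm) x₀ hx₀).deriv, mul_comm]

theorem intervalIntegrable_of_locallyIntegrableOn {E : Type*} [NormedAddCommGroup E]
    {a b x y : ℝ} {f : ℝ → E} (hf : LocallyIntegrableOn f (Ioo a b)) (hx : x ∈ Ioo a b)
    (hy : y ∈ Ioo a b) : IntervalIntegrable f volume x y :=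
  (hf.integrableOn_compact_subset (uIcc_subset_Ioo hx hy) isCompact_uIcc).intervalIntegrable

theorem setIntegral_deriv_smul_integral {a b x₀ : ℝ} {g : ℝ → ℂ} {φ : ℝ → ℝ}
    (hg : LocallyIntegrableOn g (Ioo a b)) (hx₀ : x₀ ∈ Ioo a b) (hφ : ContDiff ℝ 1 φ)
    (hφc : HasCompactSupport φ) (hφs : tsupport φ ⊆ Ioo a b) :
    ∫ x in Ioo a b, deriv φ x • ∫ t in x₀..x, g t = -∫ x in Ioo a b, φ x • g x := by
  obtain ⟨c, d, hac, hdb, hcd, hs⟩ := exists_Ioo_of_isCompact hφc hφs hx₀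
  have hlt : c < d := hcd.1.trans hcd.2
  have h0 : ∀ x ∉ Ioo c d, φ x = 0 := fun x hx =>
    image_eq_zero_of_notMem_tsupport fun h => hx (hs h)
  have h0' : ∀ x ∉ Ioo c d, deriv φ x = 0 := fun x hx => by
    by_contra h
    exact hx (hs (support_deriv_subset h))
  have hc' : c ∈ Ioo a b := ⟨hac, hlt.trans hdb⟩
  have hd' : d ∈ Ioo a b := ⟨hac.trans hlt, hdb⟩
  have hx₀' : x₀ ∈ uIcc c d := by rw [uIcc_of_le hlt.le]; exact Ioo_subset_Icc_self hcd
  have hgi : IntervalIntegrable g volume c d := intervalIntegrable_of_locallyIntegrableOn hg hc' hd'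
  have hH : ContinuousOn (fun x => ∫ t in x₀..x, g t) (uIcc c d) := by
    have := intervalIntegral.continuousOn_primitive_interval' hgi hx₀'
    exact this
  rw [setIntegral_Ioo_eq_intervalIntegral hac hlt.le hdb fun x hx => by rw [h0' x hx, zero_smul],
    setIntegral_Ioo_eq_intervalIntegral hac hlt.le hdb fun x hx => by rw [h0 x hx, zero_smul]]
  -- The integration by parts is real-valued, so it is applied to the real and imaginary parts.
  have key : ∀ L : ℂ →L[ℝ] ℝ, L (∫ x in c..d, deriv φ x • ∫ t in x₀..x, g t) =
      L (-∫ x in c..d, φ x • g x) := by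
    intro L
    have hi1 : IntervalIntegrable (fun x => deriv φ x • ∫ t in x₀..x, g t) volume c d :=
      ((hφ.continuous_deriv le_rfl).continuousOn.smul hH).intervalIntegrable
    have hi2 : IntervalIntegrable (fun x => φ x • g x) volume c d :=
      hgi.continuousOn_smul hφ.continuous.continuousOn
    have hLg : IntervalIntegrable (fun x => L (g x)) volume c d :=
      ⟨L.integrable_comp hgi.1, L.integrable_comp hgi.2⟩
    rw [map_neg, ← L.intervalIntegral_comp_comm hi1, ← L.intervalIntegral_comp_comm hi2]
    simp only [map_smul, smul_eq_mul]
    rw [← integral_deriv_mul_integral hLg hx₀' hφ (h0 c (by simp)) (h0 d (by simp))]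
    refine intervalIntegral.integral_congr fun x hx => ?_
    have hx' : x ∈ Ioo a b := uIcc_subset_Ioo hc' hd' hx
    rw [L.intervalIntegral_comp_comm (intervalIntegrable_of_locallyIntegrableOn hg hx₀ hx')]
  exact Complex.ext (key Complex.reCLM) (key Complex.imCLM)

theorem MeasureTheory.LocallyIntegrableOn.integrable_smul_of_tsupport {a b : ℝ} {D : ℝ → ℂ} {ψ : ℝ → ℝ}
    (hD : LocallyIntegrableOn D (Ioo a b)) (hψ : Continuous ψ) (hψc : HasCompactSupport ψ)
    (hψs : tsupport ψ ⊆ Ioo a b) :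
    Integrable (fun x => ψ x • D x) (volume.restrict (Ioo a b)) := by
  have h1 : IntegrableOn (fun x => ψ x • D x) (tsupport ψ) :=
    (hD.integrableOn_compact_subset hψs hψc).continuousOn_smul hψ.continuousOn hψc
  refine h1.of_forall_sdiff_eq_zero measurableSet_Ioo fun x hx => ?_
  rw [image_eq_zero_of_notMem_tsupport hx.2, zero_smul]

/-- A test function with mean zero is the derivative of a test function. Subtracting `(∫ ψ) ρ`,
where `ρ` is a bump of integral one, gives any `ψ` mean zero, so `D` acts on test functions as the
constant `∫ ρ D`. -/
theorem ae_eq_const_of_integral_deriv_smul_eq_zero {a b : ℝ} (hab : a < b) {D : ℝ → ℂ}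
    (hD : LocallyIntegrableOn D (Ioo a b))
    (h : ∀ φ : ℝ → ℝ, ContDiff ℝ ∞ φ → HasCompactSupport φ → tsupport φ ⊆ Ioo a b →
      ∫ x in Ioo a b, deriv φ x • D x = 0) :
    ∃ c : ℂ, ∀ᵐ x, x ∈ Ioo a b → D x = c := by
  obtain ⟨x₀, hx₀⟩ := nonempty_Ioo.2 hab
  obtain ⟨r, hr, hrs⟩ := Metric.isOpen_iff.1 isOpen_Ioo x₀ hx₀
  let B : ContDiffBump x₀ := ⟨r / 4, r / 2, by positivity, by linarith⟩
  set ρ : ℝ → ℝ := B.normed volume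
  have hρ : ContDiff ℝ ∞ ρ := B.contDiff_normed
  have hρc : HasCompactSupport ρ := B.hasCompactSupport_normed
  have hρs : tsupport ρ ⊆ Ioo a b := by
    rw [B.tsupport_normed_eq]
    exact (Metric.closedBall_subset_ball (by simp [B]; linarith)).trans hrs
  have hρi : ∫ x, ρ x = 1 := B.integral_normed
  refine ⟨∫ x in Ioo a b, ρ x • D x, ?_⟩
  set C := ∫ x in Ioo a b, ρ x • D x with hC
  have hmain := isOpen_Ioo.ae_eq_zero_of_integral_contDiff_smul_eq_zero
    (f := fun x => D x - C) (μ := volume) (U := Ioo a b)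
    (hD.sub ((locallyIntegrable_const C).locallyIntegrableOn _)) ?_
  · filter_upwards [hmain] with x hx hxm
    exact sub_eq_zero.1 (hx hxm)
  intro ψ hψ hψc hψs
  set s := ∫ x, ψ x with hs
  set θ : ℝ → ℝ := fun x => ψ x - s * ρ x with hθ
  have hθ' : ContDiff ℝ ∞ θ := hψ.sub (contDiff_const.mul hρ)
  obtain ⟨c, d, hac, hdb, hcd, hsub⟩ :=
    exists_Ioo_of_isCompact (hψc.union hρc) (union_subset hψs hρs) hx₀
  have hlt : c < d := hcd.1.trans hcd.2
  have hψ0 : ∀ x ∉ Ioo c d, ψ x = 0 := fun x hx =>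
    image_eq_zero_of_notMem_tsupport fun h => hx (hsub (Or.inl h))
  have hρ0 : ∀ x ∉ Ioo c d, ρ x = 0 := fun x hx =>
    image_eq_zero_of_notMem_tsupport fun h => hx (hsub (Or.inr h))
  have hθ0 : ∀ x ∉ Ioo c d, θ x = 0 := fun x hx => by simp [hθ, hψ0 x hx, hρ0 x hx]
  have hwhole : ∀ f : ℝ → ℝ, (∀ x ∉ Ioo c d, f x = 0) → ∫ x, f x = ∫ x in c..d, f x := by
    intro f hf
    rw [intervalIntegral.integral_of_le hlt.le]
    refine (setIntegral_eq_integral_of_forall_compl_eq_zero fun x hx => hf x fun h => hx ?_).symm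
    exact ⟨h.1, h.2.le⟩
  have hθi : ∫ x in c..d, θ x = 0 := by
    rw [← hwhole θ hθ0, hθ, integral_sub (hψ.continuous.integrable_of_hasCompactSupport hψc)
      ((hρ.continuous.integrable_of_hasCompactSupport hρc).const_mul s), integral_const_mul, hρi]
    simp [hs]
  set φ : ℝ → ℝ := fun x => ∫ t in c..x, θ t with hφ
  have hφd : ∀ x, HasDerivAt φ (θ x) x := fun x => intervalIntegral.integral_hasDerivAt_right
    (hθ'.continuous.intervalIntegrable _ _) (hθ'.continuous.stronglyMeasurableAtFilter _ _)
    hθ'.continuous.continuousAt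
  have hdφ : deriv φ = θ := funext fun x => (hφd x).deriv
  have hφ' : ContDiff ℝ ∞ φ :=
    contDiff_infty_iff_deriv.2 ⟨fun x => (hφd x).differentiableAt, hdφ ▸ hθ'⟩
  -- The mean of `θ` is zero, so its primitive from `c` vanishes again to the right of `d`.
  have hφ0 : ∀ x ∉ Icc c d, φ x = 0 := by
    intro x hx
    rcases lt_or_ge x c with hxc | hxc
    · refine intervalIntegral.integral_zero_ae (Filter.Eventually.of_forall fun t ht => hθ0 t ?_)
      rw [uIoc_of_ge hxc.le] at ht
      exact fun h => h.1.not_ge ht.2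
    · have hxd : d < x := lt_of_not_ge fun h => hx ⟨hxc, h⟩
      rw [hφ]
      simp only
      rw [← intervalIntegral.integral_add_adjacent_intervals
        (hθ'.continuous.intervalIntegrable c d) (hθ'.continuous.intervalIntegrable d x), hθi,
        zero_add]
      refine intervalIntegral.integral_zero_ae (Filter.Eventually.of_forall fun t ht => hθ0 t ?_)
      rw [uIoc_of_le hxd.le] at ht
      exact fun h => h.2.not_gt ht.1
  have hφs : tsupport φ ⊆ Icc c d := closure_minimal (fun x hx => by
    by_contra h; exact hx (hφ0 x h)) isClosed_Icc
  have h1 := h φ hφ' (isCompact_Icc.of_isClosed_subset (isClosed_tsupport _) hφs)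
    (hφs.trans (Icc_subset_Ioo hac hdb))
  have hψD := hD.integrable_smul_of_tsupport hψ.continuous hψc hψs
  have hρD := hD.integrable_smul_of_tsupport hρ.continuous hρc hρs
  have h2 : ∫ x in Ioo a b, ψ x • D x = s • C := by
    rw [hdφ] at h1
    simp only [hθ, sub_smul, mul_smul] at h1
    have h4 := integral_sub hψD (hρD.smul s)
    simp only [Pi.smul_apply] at h4
    rw [h4, integral_smul, sub_eq_zero] at h1
    exact h1
  have h3 : ∫ x in Ioo a b, ψ x • C = s • C := by
    rw [integral_smul_const, hs]
    congr 1
    refine setIntegral_eq_integral_of_forall_compl_eq_zero fun x hx => ?_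
    exact image_eq_zero_of_notMem_tsupport fun h => hx (hψs h)
  rw [← setIntegral_eq_integral_of_forall_compl_eq_zero (s := Ioo a b)]
  · simp only [smul_sub]
    rw [integral_sub hψD, h2, h3, sub_self]
    exact ((hψ.continuous.integrable_of_hasCompactSupport hψc).smul_const C).integrableOn
  · intro x hx
    rw [image_eq_zero_of_notMem_tsupport fun h => hx (hψs h), zero_smul]

theorem continuousOn_integral_of_locallyIntegrableOn {a b x₀ : ℝ} {g : ℝ → ℂ}
    (hg : LocallyIntegrableOn g (Ioo a b)) (hx₀ : x₀ ∈ Ioo a b) :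
    ContinuousOn (fun x => ∫ t in x₀..x, g t) (Ioo a b) := by
  intro x hx
  obtain ⟨c, d, hac, hdb, hcd, hs⟩ :=
    exists_Ioo_of_isCompact (isCompact_singleton (x := x)) (singleton_subset_iff.2 hx) hx₀
  have hx' : x ∈ Ioo c d := singleton_subset_iff.1 hs
  have hlt : c < d := hcd.1.trans hcd.2
  have := intervalIntegral.continuousOn_primitive_interval' (μ := volume)
    (intervalIntegrable_of_locallyIntegrableOn hg ⟨hac, hlt.trans hdb⟩ ⟨hac.trans hlt, hdb⟩)
    (show x₀ ∈ uIcc c d by rw [uIcc_of_le hlt.le]; exact Ioo_subset_Icc_self hcd)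
  rw [uIcc_of_le hlt.le] at this
  exact (this.continuousAt (Icc_mem_nhds hx'.1 hx'.2)).continuousWithinAt

/-- A locally integrable function with locally integrable weak derivative `g` is almost everywhere
equal to a primitive of `g`. -/
theorem ae_eq_integral_of_weakDeriv {a b x₀ : ℝ} {f g : ℝ → ℂ}
    (hf : LocallyIntegrableOn f (Ioo a b)) (hg : LocallyIntegrableOn g (Ioo a b))
    (hx₀ : x₀ ∈ Ioo a b)
    (h : ∀ φ : ℝ → ℝ, ContDiff ℝ ∞ φ → HasCompactSupport φ → tsupport φ ⊆ Ioo a b →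
      ∫ x in Ioo a b, deriv φ x • f x = -∫ x in Ioo a b, φ x • g x) :
    ∃ c : ℂ, ∀ᵐ x, x ∈ Ioo a b → f x = c + ∫ t in x₀..x, g t := by
  have hH := continuousOn_integral_of_locallyIntegrableOn hg hx₀
  have hHl := hH.locallyIntegrableOn (μ := volume) measurableSet_Ioo
  -- It remains to see that `f` minus a primitive of `g` has zero weak derivative.
  suffices h0 : _ from
    (ae_eq_const_of_integral_deriv_smul_eq_zero (hx₀.1.trans hx₀.2) (hf.sub hHl) h0).imp
      fun c hc => hc.mono fun x hx hxm => by rw [← hx hxm]; simp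
  intro φ hφ hφc hφs
  have hφ1 : ContDiff ℝ 1 φ := hφ.of_le (by simp)
  have hd := hφ1.continuous_deriv le_rfl
  have hds : tsupport (deriv φ) ⊆ Ioo a b :=
    (closure_minimal support_deriv_subset (isClosed_tsupport _)).trans hφs
  simp only [Pi.sub_apply, smul_sub]
  rw [integral_sub (hf.integrable_smul_of_tsupport hd hφc.deriv hds)
    (hHl.integrable_smul_of_tsupport hd hφc.deriv hds), h φ hφ hφc hφs,
    setIntegral_deriv_smul_integral hg hx₀ hφ1 hφc hφs, sub_self]

end DuBoisReymond

/-! ### The integrating factor and its asymptotics. -/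

namespace KerrDeSitter

variable {Λ : ℝ} (hΛ : 0 ≤ Λ) (a : ℝ)

/-- The coefficient `q` for `k + 1/2 = 1`. -/
noncomputable def qUnit (Λ a x : ℝ) : ℝ :=
  Xi Λ a / (√(Delta Λ a (theta Λ a x)) * Real.sin (theta Λ a x))

/-- A primitive of `qUnit` in the variable `ϑ`. -/
noncomputable def logTheta (Λ a ϑ : ℝ) : ℝ :=
  (Real.log (1 - Real.cos ϑ) - Real.log (1 + Real.cos ϑ)) / 2 -
    √(sigma Λ a) * Real.arctan (√(sigma Λ a) * Real.cos ϑ)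

/-- The function `exp (κ ∫ qUnit)`. With `κ = k + 1/2` it solves `w' = q w`. -/
noncomputable def weight (Λ a κ x : ℝ) : ℝ := Real.exp (κ * logTheta Λ a (theta Λ a x))

theorem q_eq (Λ a k x : ℝ) : q Λ a k x = (k + 1 / 2) * qUnit Λ a x := by
  unfold q qUnit; ring

theorem weight_pos (Λ a κ x : ℝ) : 0 < weight Λ a κ x := Real.exp_pos _

theorem weight_neg (Λ a κ x : ℝ) : weight Λ a (-κ) x = (weight Λ a κ x)⁻¹ := by
  rw [weight, weight, ← Real.exp_neg]; ring_nf

theorem mem_I {x : ℝ} : x ∈ I Λ a ↔ x ∈ Ioo 0 (xEnd Λ a) := Iff.rfl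

include hΛ

theorem one_le_Xi : 1 ≤ Xi Λ a := by
  have := sigma_nonneg hΛ a
  unfold Xi; linarith

theorem xEnd_pos : 0 < xEnd Λ a := by
  have := strictMono_xCoord hΛ a Real.pi_pos
  rwa [xCoord_zero] at this

omit hΛ in
theorem one_sub_cos_pos {ϑ : ℝ} (hϑ : ϑ ∈ Ioo 0 Real.pi) : 0 < 1 - Real.cos ϑ := by
  have h1 := Real.cos_lt_cos_of_nonneg_of_le_pi le_rfl hϑ.2.le hϑ.1
  rw [Real.cos_zero] at h1
  linarith

omit hΛ in
theorem one_add_cos_pos {ϑ : ℝ} (hϑ : ϑ ∈ Ioo 0 Real.pi) : 0 < 1 + Real.cos ϑ := by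
  have h2 := Real.cos_lt_cos_of_nonneg_of_le_pi hϑ.1.le le_rfl hϑ.2
  rw [Real.cos_pi] at h2
  linarith

/-- Since `Ξ = Δ_ϑ + σ sin² ϑ`, the derivative splits as `1 / sin ϑ + σ sin ϑ / Δ_ϑ`; these are the
derivatives of the logarithmic and the arctangent term. -/
theorem hasDerivAt_logTheta {ϑ : ℝ} (hϑ : ϑ ∈ Ioo 0 Real.pi) :
    HasDerivAt (logTheta Λ a) (Xi Λ a / (Delta Λ a ϑ * Real.sin ϑ)) ϑ := by
  have h1 := one_sub_cos_pos hϑ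
  have h2 := one_add_cos_pos hϑ
  have hs := Real.sin_pos_of_pos_of_lt_pi hϑ.1 hϑ.2
  have hD := Delta_pos hΛ a ϑ
  have hc := Real.hasDerivAt_cos ϑ
  have e := (((hc.const_sub 1).log h1.ne').sub ((hc.const_add 1).log h2.ne')).div_const 2 |>.sub
    ((hc.const_mul √(sigma Λ a)).arctan.const_mul √(sigma Λ a))
  refine e.congr_deriv ?_
  have hsq : √(sigma Λ a) ^ 2 = sigma Λ a := Real.sq_sqrt (sigma_nonneg hΛ a)
  have hD' : 1 + (√(sigma Λ a) * Real.cos ϑ) ^ 2 = Delta Λ a ϑ := by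
    rw [mul_pow, hsq]; rfl
  rw [hD']
  have hss : Real.sin ϑ ^ 2 = (1 - Real.cos ϑ) * (1 + Real.cos ϑ) := by
    rw [Real.sin_sq]; ring
  have e1 : (- -Real.sin ϑ / (1 - Real.cos ϑ) - -Real.sin ϑ / (1 + Real.cos ϑ)) / 2 =
      1 / Real.sin ϑ := by
    field_simp
    rw [hss]
    ring
  rw [e1]
  field_simp
  rw [hsq, hss]
  unfold Xi Delta
  ring

theorem hasDerivAt_theta {x : ℝ} (hx : x ∈ I Λ a) :
    HasDerivAt (theta Λ a) √(Delta Λ a (theta Λ a x)) x := by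
  have h := HasDerivAt.of_local_left_inverse (f := xCoord Λ a)
    ((continuousOn_theta hΛ a).continuousAt ((I Λ a).2.mem_nhds hx))
    (hasDerivAt_xCoord hΛ a (theta Λ a x))
    (one_div_pos.2 (Real.sqrt_pos.2 (Delta_pos hΛ a _))).ne'
    (Filter.eventually_of_mem ((I Λ a).2.mem_nhds hx) fun y hy => xCoord_theta hΛ a hy)
  rwa [one_div, inv_inv] at h

theorem hasDerivAt_logTheta_theta {x : ℝ} (hx : x ∈ I Λ a) :
    HasDerivAt (fun x => logTheta Λ a (theta Λ a x)) (qUnit Λ a x) x := by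
  refine ((hasDerivAt_logTheta hΛ a (theta_mem hΛ a hx)).comp x
    (hasDerivAt_theta hΛ a hx)).congr_deriv ?_
  have hm := theta_mem hΛ a hx
  have hs := Real.sin_pos_of_pos_of_lt_pi hm.1 hm.2
  have hD := Real.sqrt_pos.2 (Delta_pos hΛ a (theta Λ a x))
  unfold qUnit
  rw [← Real.sq_sqrt (Delta_pos hΛ a (theta Λ a x)).le, Real.sqrt_sq hD.le]
  field_simp

theorem hasDerivAt_weight (κ : ℝ) {x : ℝ} (hx : x ∈ I Λ a) :
    HasDerivAt (weight Λ a κ) (κ * qUnit Λ a x * weight Λ a κ x) x := by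
  refine ((hasDerivAt_logTheta_theta hΛ a hx).const_mul κ).exp.congr_deriv ?_
  rw [weight]; ring

theorem continuousOn_weight (κ : ℝ) : ContinuousOn (weight Λ a κ) (I Λ a) := fun _ hx =>
  (hasDerivAt_weight hΛ a κ hx).continuousAt.continuousWithinAt

theorem qUnit_pos {x : ℝ} (hx : x ∈ I Λ a) : 0 < qUnit Λ a x := by
  have hm := theta_mem hΛ a hx
  have hs := Real.sin_pos_of_pos_of_lt_pi hm.1 hm.2
  have hD := Real.sqrt_pos.2 (Delta_pos hΛ a (theta Λ a x))
  have := one_le_Xi hΛ a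
  unfold qUnit; positivity

theorem monotoneOn_weight {κ : ℝ} (hκ : 0 ≤ κ) : MonotoneOn (weight Λ a κ) (I Λ a) := by
  refine monotoneOn_of_deriv_nonneg (convex_Ioo _ _) (continuousOn_weight hΛ a κ) ?_ ?_ <;>
    change ∀ x ∈ interior (Ioo 0 (xEnd Λ a)), _ <;> rw [interior_Ioo] <;> intro x hx
  · exact (hasDerivAt_weight hΛ a κ hx).differentiableAt.differentiableWithinAt
  · rw [(hasDerivAt_weight hΛ a κ hx).deriv]
    have := qUnit_pos hΛ a hx
    have := weight_pos Λ a κ x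
    positivity

/-! ### Reflection -/

omit hΛ in
theorem Delta_pi_sub (Λ a ϑ : ℝ) : Delta Λ a (Real.pi - ϑ) = Delta Λ a ϑ := by
  simp [Delta, Real.cos_pi_sub]

theorem xCoord_pi_sub (ϑ : ℝ) : xCoord Λ a (Real.pi - ϑ) = xEnd Λ a - xCoord Λ a ϑ := by
  have hc := continuous_density hΛ a
  have h := intervalIntegral.integral_comp_sub_left (a := ϑ) (b := Real.pi)
    (fun t => 1 / √(Delta Λ a t)) Real.pi
  simp only [Delta_pi_sub, sub_self] at h
  rw [xEnd, xCoord, xCoord, xCoord, ← h,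
    intervalIntegral.integral_interval_sub_left (hc.intervalIntegrable _ _)
      (hc.intervalIntegrable _ _)]

omit hΛ in
theorem reflect_mem {x : ℝ} (hx : x ∈ I Λ a) : xEnd Λ a - x ∈ I Λ a := by
  rw [mem_I] at *
  constructor <;> linarith [hx.1, hx.2]

theorem theta_reflect {x : ℝ} (hx : x ∈ I Λ a) :
    theta Λ a (xEnd Λ a - x) = Real.pi - theta Λ a x := by
  have hm := theta_mem hΛ a hx
  rw [← theta_xCoord hΛ a (ϑ := Real.pi - theta Λ a x) ⟨by linarith [hm.2], by linarith [hm.1]⟩,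
    xCoord_pi_sub hΛ a, xCoord_theta hΛ a hx]

theorem qUnit_reflect {x : ℝ} (hx : x ∈ I Λ a) : qUnit Λ a (xEnd Λ a - x) = qUnit Λ a x := by
  rw [qUnit, theta_reflect hΛ a hx, Delta_pi_sub, Real.sin_pi_sub, qUnit]

theorem q_reflect (k : ℝ) {x : ℝ} (hx : x ∈ I Λ a) : q Λ a k (xEnd Λ a - x) = q Λ a k x := by
  rw [q_eq, q_eq, qUnit_reflect hΛ a hx]

/-- `logTheta` is odd under `ϑ ↦ π - ϑ`. Thus the behaviour of a weight at the right endpoint is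
that of the opposite exponent at the left one. -/
theorem weight_reflect (κ : ℝ) {x : ℝ} (hx : x ∈ I Λ a) :
    weight Λ a κ (xEnd Λ a - x) = weight Λ a (-κ) x := by
  rw [weight, theta_reflect hΛ a hx, weight, logTheta, logTheta, Real.cos_pi_sub, mul_neg,
    Real.arctan_neg]
  congr 1
  ring_nf

/-! ### Behaviour of the weight at the left endpoint -/

omit hΛ in
/-- The midpoint of `I`. -/
noncomputable def xMid (Λ a : ℝ) : ℝ := xCoord Λ a (Real.pi / 2)

theorem xMid_mem : xMid Λ a ∈ I Λ a := by
  rw [← SetLike.mem_coe, ← image_xCoord hΛ a]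
  exact ⟨_, ⟨by positivity, by linarith [Real.pi_pos]⟩, rfl⟩

theorem xMid_eq : xEnd Λ a - xMid Λ a = xMid Λ a := by
  have := xCoord_pi_sub hΛ a (Real.pi / 2)
  rw [xMid, ← this]; congr 1; ring

theorem xCoord_le {ϑ : ℝ} (hϑ : 0 ≤ ϑ) : xCoord Λ a ϑ ≤ ϑ := by
  have h : xCoord Λ a ϑ ≤ ∫ _ in (0 : ℝ)..ϑ, (1 : ℝ) := by
    refine intervalIntegral.integral_mono_on hϑ ((continuous_density hΛ a).intervalIntegrable _ _)
      intervalIntegrable_const fun t _ => ?_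
    have h1 : 1 ≤ √(Delta Λ a t) := by
      rw [Real.one_le_sqrt]
      have := sigma_nonneg hΛ a
      unfold Delta
      nlinarith [sq_nonneg (Real.cos t)]
    exact div_le_one_of_le₀ h1 (by positivity)
  simpa using h

theorem le_xCoord {ϑ : ℝ} (hϑ : 0 ≤ ϑ) : ϑ / √(Xi Λ a) ≤ xCoord Λ a ϑ := by
  have h : ∫ _ in (0 : ℝ)..ϑ, 1 / √(Xi Λ a) ≤ xCoord Λ a ϑ := by
    refine intervalIntegral.integral_mono_on hϑ intervalIntegrable_const
      ((continuous_density hΛ a).intervalIntegrable _ _) fun t _ => ?_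
    refine one_div_le_one_div_of_le (Real.sqrt_pos.2 (Delta_pos hΛ a t)) (Real.sqrt_le_sqrt ?_)
    have := sigma_nonneg hΛ a
    unfold Delta Xi
    nlinarith [Real.cos_sq_le_one t]
  simpa [div_eq_mul_inv] using h

/-- For `ϑ ≤ π/2` the quantity `1 - cos ϑ` is comparable to `ϑ²` and `x` is comparable to `ϑ`, while
the remaining terms are bounded. -/
theorem abs_logTheta_sub_log_le :
    ∃ C, ∀ x ∈ Ioc 0 (xMid Λ a), |logTheta Λ a (theta Λ a x) - Real.log x| ≤ C := by
  -- The summands come from `2ϑ²/π² ≤ 1 - cos ϑ`, from `1 + cos ϑ ≤ 2`, from the arctangent, and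
  -- from `ϑ / √Ξ ≤ x`.
  refine ⟨|Real.log (2 / Real.pi ^ 2)| + Real.log 2 + √(sigma Λ a) * (Real.pi / 2) +
    Real.log √(Xi Λ a), fun x hx => ?_⟩
  have hxI : x ∈ I Λ a := ⟨hx.1, hx.2.trans_lt (xMid_mem hΛ a).2⟩
  set ϑ := theta Λ a x with hϑ
  have hm : ϑ ∈ Ioo 0 Real.pi := theta_mem hΛ a hxI
  have hxϑ : xCoord Λ a ϑ = x := xCoord_theta hΛ a hxI
  have hϑ2 : ϑ ≤ Real.pi / 2 := by
    rw [← (strictMono_xCoord hΛ a).le_iff_le, hxϑ]; exact hx.2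
  have hΞ : 1 ≤ √(Xi Λ a) := Real.one_le_sqrt.2 (one_le_Xi hΛ a)
  have hΞ0 : 0 < √(Xi Λ a) := by linarith
  have hx1 : Real.log x ≤ Real.log ϑ :=
    Real.log_le_log hx.1 (hxϑ ▸ xCoord_le hΛ a hm.1.le)
  have hx2 : Real.log ϑ - Real.log √(Xi Λ a) ≤ Real.log x := by
    rw [← Real.log_div hm.1.ne' hΞ0.ne']
    exact Real.log_le_log (div_pos hm.1 hΞ0) (hxϑ ▸ le_xCoord hΛ a hm.1.le)
  have hc1 : Real.log (1 - Real.cos ϑ) ≤ 2 * Real.log ϑ := by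
    have := Real.one_sub_sq_div_two_le_cos (x := ϑ)
    rw [← Nat.cast_ofNat, ← Real.log_pow]
    exact Real.log_le_log (one_sub_cos_pos hm) (by nlinarith [sq_nonneg ϑ])
  have hc2 : Real.log (2 / Real.pi ^ 2) + 2 * Real.log ϑ ≤ Real.log (1 - Real.cos ϑ) := by
    have := Real.cos_le_one_sub_mul_cos_sq (x := ϑ) (by rw [abs_of_pos hm.1]; exact hm.2.le)
    have hp : 0 < 2 / Real.pi ^ 2 := by positivity
    have hp2 : 0 < ϑ ^ 2 := by have := hm.1; positivity
    have e : 2 * Real.log ϑ = Real.log (ϑ ^ 2) := by rw [Real.log_pow]; norm_num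
    rw [e, ← Real.log_mul hp.ne' hp2.ne']
    exact Real.log_le_log (by positivity) (by linarith)
  have hcos : 0 ≤ Real.cos ϑ :=
    Real.cos_nonneg_of_neg_pi_div_two_le_of_le (by linarith [hm.1, Real.pi_pos]) hϑ2
  have hd1 : 0 ≤ Real.log (1 + Real.cos ϑ) := Real.log_nonneg (by linarith)
  have hd2 : Real.log (1 + Real.cos ϑ) ≤ Real.log 2 :=
    Real.log_le_log (by linarith) (by linarith [Real.cos_le_one ϑ])
  have ha1 : √(sigma Λ a) * Real.arctan (√(sigma Λ a) * Real.cos ϑ) ≤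
      √(sigma Λ a) * (Real.pi / 2) :=
    mul_le_mul_of_nonneg_left (Real.arctan_lt_pi_div_two _).le (Real.sqrt_nonneg _)
  have ha2 : 0 ≤ √(sigma Λ a) * Real.arctan (√(sigma Λ a) * Real.cos ϑ) :=
    mul_nonneg (Real.sqrt_nonneg _) (Real.arctan_nonneg.2 (by positivity))
  have hΞl : 0 ≤ Real.log √(Xi Λ a) := Real.log_nonneg hΞ
  have hab := neg_abs_le (Real.log (2 / Real.pi ^ 2))
  have hab' := abs_nonneg (Real.log (2 / Real.pi ^ 2))
  unfold logTheta
  rw [abs_le]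
  constructor <;> linarith

theorem weight_bounds (κ : ℝ) : ∃ C > 0, ∀ x ∈ Ioc 0 (xMid Λ a),
    weight Λ a κ x ≤ C * x ^ κ ∧ x ^ κ ≤ C * weight Λ a κ x := by
  obtain ⟨C, hC⟩ := abs_logTheta_sub_log_le hΛ a
  refine ⟨Real.exp (|κ| * C), Real.exp_pos _, fun x hx => ?_⟩
  have h := hC x hx
  have h1 : |κ * (logTheta Λ a (theta Λ a x) - Real.log x)| ≤ |κ| * C := by
    rw [abs_mul]; gcongr
  rw [abs_le] at h1
  rw [Real.rpow_def_of_pos hx.1, weight, ← Real.exp_add, ← Real.exp_add]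
  constructor <;> refine Real.exp_le_exp.2 ?_ <;> nlinarith

theorem aestronglyMeasurable_weight (κ : ℝ) {c : ℝ} (hc : c ≤ xEnd Λ a) :
    AEStronglyMeasurable (weight Λ a κ) (volume.restrict (Ioo 0 c)) :=
  ((continuousOn_weight hΛ a κ).mono (Ioo_subset_Ioo_right hc)).aestronglyMeasurable
    measurableSet_Ioo

/-- The weight is comparable to `x ^ κ`, and `x ^ (2κ)` is integrable at `0` exactly when `2κ > -1`.
-/
theorem memLp_weight_iff (κ : ℝ) {c : ℝ} (hc : c ∈ Ioc 0 (xMid Λ a)) :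
    MemLp (weight Λ a κ) 2 (volume.restrict (Ioo 0 c)) ↔ -1 / 2 < κ := by
  have hcE : c ≤ xEnd Λ a := hc.2.trans (xMid_mem hΛ a).2.le
  have hm := aestronglyMeasurable_weight hΛ a κ hcE
  obtain ⟨C, hC, hb⟩ := weight_bounds hΛ a κ
  have hsub : ∀ x ∈ Ioo 0 c, x ∈ Ioc 0 (xMid Λ a) := fun x hx => ⟨hx.1, hx.2.le.trans hc.2⟩
  have hpow : ∀ x : ℝ, 0 < x → (x ^ κ) ^ 2 = x ^ (2 * κ) := fun x hx => by
    rw [← Real.rpow_natCast, ← Real.rpow_mul hx.le]; congr 1; push_cast; ring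
  rw [memLp_two_iff_integrable_sq hm]
  have hiff := intervalIntegral.integrableOn_Ioo_rpow_iff (s := 2 * κ) hc.1
  have hmr : AEStronglyMeasurable (fun x : ℝ => x ^ (2 * κ)) (volume.restrict (Ioo 0 c)) :=
    (measurable_id.pow_const _).aestronglyMeasurable
  constructor
  · intro h
    have : IntegrableOn (fun x : ℝ => x ^ (2 * κ)) (Ioo 0 c) := by
      refine Integrable.mono' (h.const_mul (C ^ 2)) hmr ?_
      filter_upwards [ae_restrict_mem measurableSet_Ioo] with x hx
      have hp := Real.rpow_nonneg hx.1.le κ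
      rw [← hpow x hx.1, Real.norm_of_nonneg (by positivity), ← mul_pow]
      exact pow_le_pow_left₀ hp (hb x (hsub x hx)).2 2
    have := hiff.1 this
    linarith
  · intro h
    have h2 : IntegrableOn (fun x : ℝ => x ^ (2 * κ)) (Ioo 0 c) := hiff.2 (by linarith)
    refine Integrable.mono' (h2.const_mul (C ^ 2)) (hm.pow 2) ?_
    filter_upwards [ae_restrict_mem measurableSet_Ioo] with x hx
    have hw := (weight_pos Λ a κ x).le
    rw [← hpow x hx.1, Real.norm_of_nonneg (by positivity), ← mul_pow]
    exact pow_le_pow_left₀ hw (hb x (hsub x hx)).1 2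

/-- The lower bound on `κ` serves the left endpoint; the upper bound serves the right one, after
reflection. -/
theorem memLp_weight {κ : ℝ} (h1 : -1 / 2 < κ) (h2 : κ < 1 / 2) :
    MemLp (weight Λ a κ) 2 (mu Λ a) := by
  have hmid : xMid Λ a ∈ Ioc 0 (xMid Λ a) := ⟨(xMid_mem hΛ a).1, le_rfl⟩
  have hl := (memLp_weight_iff hΛ a κ hmid).2 h1
  have hr := (memLp_weight_iff hΛ a (-κ) hmid).2 (by linarith)
  have hmp : MeasurePreserving (fun x => xEnd Λ a - x) (volume.restrict (Ioo (xMid Λ a) (xEnd Λ a)))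
      (volume.restrict (Ioo 0 (xMid Λ a))) := by
    have h := (Measure.measurePreserving_sub_left volume (xEnd Λ a)).restrict_preimage
      (s := Ioo 0 (xMid Λ a)) measurableSet_Ioo
    rwa [preimage_const_sub_Ioo, xMid_eq hΛ a, sub_zero] at h
  have hr' : MemLp (weight Λ a κ) 2 (volume.restrict (Ioo (xMid Λ a) (xEnd Λ a))) := by
    refine (memLp_congr_ae ?_).1 (hr.comp_measurePreserving hmp)
    filter_upwards [ae_restrict_mem measurableSet_Ioo] with x hx
    have hxI : x ∈ I Λ a := ⟨(xMid_mem hΛ a).1.trans hx.1, hx.2⟩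
    rw [Function.comp, weight_reflect hΛ a _ hxI, neg_neg]
  have hm : AEStronglyMeasurable (weight Λ a κ) (mu Λ a) :=
    aestronglyMeasurable_weight hΛ a κ le_rfl
  rw [memLp_two_iff_integrable_sq hm]
  have hu := IntegrableOn.union ((integrableOn_Ioc_iff_integrableOn_Ioo (by simp)).2 hl.integrable_sq)
    hr'.integrable_sq
  rwa [Ioc_union_Ioo_eq_Ioo (xMid_mem hΛ a).1.le (xMid_mem hΛ a).2] at hu

end KerrDeSitter

/-! ### Endpoint estimates for weighted first-order equations. -/

section Endpoint

open Filter Topology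

variable {c : ℝ} {W : ℝ → ℝ} {u v : ℝ → ℂ} {z : ℂ}

/-- The integral on the right starts at `0` and not at `s`, so for a fixed `B` the bound does not
depend on `s`. -/
theorem norm_sub_le_of_hasDerivAt_mul {f g : ℝ → ℂ} {ω : ℝ → ℝ} {B s x : ℝ} (hs : 0 < s)
    (hsx : s ≤ x) (hxc : x ≤ c) (hω : ContinuousOn ω (Ioc 0 c)) (hg : ContinuousOn g (Ioc 0 c))
    (hgi : IntervalIntegrable g volume 0 c)
    (hf : ∀ x ∈ Ioc 0 c, HasDerivAt f (z * (ω x * g x)) x)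
    (hB : ∀ t ∈ Icc s x, |ω t| ≤ B) :
    ‖f x - f s‖ ≤ ‖z‖ * (B * ∫ t in (0 : ℝ)..x, ‖g t‖) := by
  have hsub : Icc s x ⊆ Ioc 0 c := fun t ht => ⟨hs.trans_le ht.1, ht.2.trans hxc⟩
  have hcont : ContinuousOn (fun x => z * (ω x * g x)) (uIcc s x) := by
    rw [uIcc_of_le hsx]
    exact continuousOn_const.mul ((Complex.continuous_ofReal.comp_continuousOn
      (hω.mono hsub)).mul (hg.mono hsub))
  rw [← intervalIntegral.integral_eq_sub_of_hasDerivAt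
    (fun t ht => hf t (hsub (by rwa [uIcc_of_le hsx] at ht))) hcont.intervalIntegrable,
    intervalIntegral.integral_const_mul, norm_mul]
  have hg0x : IntervalIntegrable g volume 0 x := by
    refine hgi.mono_set ?_
    rw [uIcc_of_le (hs.le.trans hsx), uIcc_of_le (hs.le.trans (hsx.trans hxc))]
    exact Icc_subset_Icc_right hxc
  have hgsx : IntervalIntegrable g volume s x := by
    refine hg0x.mono_set ?_
    rw [uIcc_of_le (hs.le.trans hsx), uIcc_of_le hsx]
    exact Icc_subset_Icc_left hs.le
  have hB0 : 0 ≤ B := (abs_nonneg _).trans (hB s ⟨le_rfl, hsx⟩)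
  gcongr
  calc _ ≤ ∫ t in s..x, B * ‖g t‖ := by
        refine intervalIntegral.norm_integral_le_of_norm_le hsx ?_ (hgsx.norm.const_mul B)
        refine Eventually.of_forall fun t ht => ?_
        rw [norm_mul, Complex.norm_real]
        exact mul_le_mul_of_nonneg_right (hB t ⟨ht.1.le, ht.2⟩) (norm_nonneg _)
    _ = B * ∫ t in s..x, ‖g t‖ := intervalIntegral.integral_const_mul _ _
    _ ≤ _ := by
      refine mul_le_mul_of_nonneg_left ?_ hB0
      refine intervalIntegral.integral_mono_interval hs.le hsx le_rfl ?_ hg0x.norm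
      exact Eventually.of_forall fun t => norm_nonneg _

theorem MeasureTheory.MemLp.intervalIntegrable_zero {g : ℝ → ℂ} (hc : 0 < c)
    (hg : MemLp g 2 (volume.restrict (Ioo 0 c))) : IntervalIntegrable g volume 0 c := by
  rw [intervalIntegrable_iff_integrableOn_Ioo_of_le hc.le]
  exact hg.integrable (by norm_num)

/-- `W⁻¹` is decreasing, so on `[x, c]` it is at most `(W x)⁻¹`. Integrating over `[x, c]` and
multiplying by `W x` leaves only the integral of `‖u‖` and the value at `c`. -/
theorem bounded_of_weighted_ode (hc : 0 < c) (hW : ∀ x ∈ Ioc 0 c, 0 < W x)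
    (hmono : MonotoneOn W (Ioc 0 c)) (hWc : ContinuousOn W (Ioc 0 c))
    (huc : ContinuousOn u (Ioc 0 c))
    (hv : ∀ x ∈ Ioc 0 c, HasDerivAt (fun x => ((W x)⁻¹ : ℝ) * v x) (z * (((W x)⁻¹ : ℝ) * u x)) x)
    (hu2 : MemLp u 2 (volume.restrict (Ioo 0 c))) : ∃ C, ∀ x ∈ Ioc 0 c, ‖v x‖ ≤ C := by
  refine ⟨‖v c‖ + ‖z‖ * ∫ t in (0 : ℝ)..c, ‖u t‖, fun x hx => ?_⟩
  have hcc : c ∈ Ioc 0 c := ⟨hc, le_rfl⟩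
  have hsub : ∀ t ∈ Icc x c, t ∈ Ioc 0 c := fun t ht => ⟨hx.1.trans_le ht.1, ht.2⟩
  have h := norm_sub_le_of_hasDerivAt_mul (ω := fun x => (W x)⁻¹) (B := (W x)⁻¹) hx.1 hx.2 le_rfl
    (hWc.inv₀ fun x hx => (hW x hx).ne') huc (hu2.intervalIntegrable_zero hc) hv fun t ht => by
      rw [abs_of_pos (inv_pos.2 (hW t (hsub t ht)))]
      exact inv_anti₀ (hW x hx) (hmono hx (hsub t ht) ht.1)
  have h1 : ‖((W x)⁻¹ : ℝ) * v x‖ ≤ ‖(((W c)⁻¹ : ℝ) : ℂ) * v c‖ +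
      ‖z‖ * ((W x)⁻¹ * ∫ t in (0 : ℝ)..c, ‖u t‖) := by
    have := norm_sub_norm_le ((((W x)⁻¹ : ℝ) : ℂ) * v x) ((((W c)⁻¹ : ℝ) : ℂ) * v c)
    rw [norm_sub_rev] at this
    linarith
  have hWx := hW x hx
  have hWcc := hW c hcc
  rw [norm_mul, norm_mul, Complex.norm_real, Complex.norm_real, Real.norm_of_nonneg (by positivity),
    Real.norm_of_nonneg (by positivity)] at h1
  have h2 := mul_le_mul_of_nonneg_left h1 hWx.le
  have h3 : W x * ((W x)⁻¹ * ‖v x‖) = ‖v x‖ := by field_simp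
  have h4 : W x * ((W c)⁻¹ * ‖v c‖ + ‖z‖ * ((W x)⁻¹ * ∫ t in (0 : ℝ)..c, ‖u t‖)) =
      W x * (W c)⁻¹ * ‖v c‖ + ‖z‖ * ∫ t in (0 : ℝ)..c, ‖u t‖ := by field_simp
  have h5 : W x * (W c)⁻¹ ≤ 1 := by
    rw [← div_eq_mul_inv]; exact div_le_one_of_le₀ (hmono hx hcc hx.2) hWcc.le
  rw [h3, h4] at h2
  refine h2.trans (add_le_add_left ?_ _)
  exact mul_le_of_le_one_left (norm_nonneg _) h5

/-- Since `W⁻¹` is not square integrable at `0` but `u` is, `W ‖u‖` gets arbitrarily small near `0`.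
Integrating from such a point, where `W ≤ W x`, bounds `‖u x‖` by a multiple of `∫₀ˣ ‖v‖`. -/
theorem tendsto_zero_of_weighted_ode (hc : 0 < c) (hW : ∀ x ∈ Ioc 0 c, 0 < W x)
    (hmono : MonotoneOn W (Ioc 0 c)) (hWc : ContinuousOn W (Ioc 0 c))
    (hvc : ContinuousOn v (Ioc 0 c))
    (hu : ∀ x ∈ Ioc 0 c, HasDerivAt (fun x => (W x : ℂ) * u x) (z * (W x * v x)) x)
    (hu2 : MemLp u 2 (volume.restrict (Ioo 0 c))) (hv2 : MemLp v 2 (volume.restrict (Ioo 0 c)))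
    (hWn : ∀ c' ∈ Ioc 0 c, ¬ MemLp (fun x => (W x)⁻¹) 2 (volume.restrict (Ioo 0 c'))) :
    Tendsto u (𝓝[>] 0) (𝓝 0) := by
  have hvi := hv2.intervalIntegrable_zero hc
  have hkey : ∀ x ∈ Ioc 0 c, ‖u x‖ ≤ ‖z‖ * ∫ t in (0 : ℝ)..x, ‖v t‖ := by
    intro x hx
    have hWx := hW x hx
    refine le_of_forall_pos_le_add fun ε hε => ?_
    -- Otherwise `W⁻¹ ≤ (W x * ε)⁻¹ ‖u‖` on `(0, x)`, which would make `W⁻¹` square integrable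
    -- there.
    obtain ⟨s, hs, hsε⟩ : ∃ s ∈ Ioo 0 x, W s * ‖u s‖ < W x * ε := by
      by_contra! hcon
      refine hWn x hx ?_
      have hmeas : AEStronglyMeasurable (fun x => (W x)⁻¹) (volume.restrict (Ioo 0 x)) :=
        ((hWc.inv₀ fun x hx => (hW x hx).ne').mono fun t ht =>
          ⟨ht.1, ht.2.le.trans hx.2⟩).aestronglyMeasurable measurableSet_Ioo
      refine ((hu2.mono_measure (Measure.restrict_mono (Ioo_subset_Ioo_right hx.2) le_rfl)).norm
        |>.const_mul (W x * ε)⁻¹).mono hmeas ?_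
      filter_upwards [ae_restrict_mem measurableSet_Ioo] with t ht
      have hWt := hW t ⟨ht.1, ht.2.le.trans hx.2⟩
      have := hcon t ht
      rw [Real.norm_of_nonneg (by positivity), Real.norm_of_nonneg (by positivity),
        inv_mul_eq_div, le_div_iff₀ (by positivity), inv_mul_le_iff₀ hWt]
      exact this
    have h := norm_sub_le_of_hasDerivAt_mul (B := W x) hs.1 hs.2.le hx.2 hWc hvc hvi hu
      fun t ht => by
        have htc : t ∈ Ioc 0 c := ⟨hs.1.trans_le ht.1, ht.2.trans hx.2⟩
        rw [abs_of_pos (hW t htc)]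
        exact hmono htc hx ht.2
    have h1 := norm_sub_norm_le ((W x : ℂ) * u x) ((W s : ℂ) * u s)
    rw [norm_mul, norm_mul, Complex.norm_real, Complex.norm_real, Real.norm_of_nonneg hWx.le,
      Real.norm_of_nonneg (hW s ⟨hs.1, hs.2.le.trans hx.2⟩).le] at h1
    refine le_of_mul_le_mul_left ?_ hWx
    linarith
  have hF : Tendsto (fun x => ‖z‖ * ∫ t in (0 : ℝ)..x, ‖v t‖) (𝓝[>] 0) (𝓝 0) := by
    have h := intervalIntegral.continuousOn_primitive_interval' hvi.norm left_mem_uIcc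
    have h0 := h 0 left_mem_uIcc
    rw [ContinuousWithinAt, intervalIntegral.integral_same, uIcc_of_le hc.le] at h0
    have h1 := h0.mono_left (nhdsWithin_mono 0 Ioc_subset_Icc_self)
    rw [nhdsWithin_Ioc_eq_nhdsGT hc] at h1
    simpa using h1.const_mul ‖z‖
  refine squeeze_zero_norm' ?_ hF
  filter_upwards [Ioc_mem_nhdsGT hc] with x hx using hkey x hx

end Endpoint

/-! ### Solutions of the eigenvalue equation and the endpoint classification. -/

namespace KerrDeSitter

open Filter Topology

variable {Λ : ℝ} (hΛ : 0 ≤ Λ) {a k : ℝ} {z : ℂ} {Φ Ψ : (ℝ → ℂ) × (ℝ → ℂ)}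

theorem I_mem_nhds {x : ℝ} (hx : x ∈ I Λ a) : (I Λ a : Set ℝ) ∈ 𝓝 x := (I Λ a).2.mem_nhds hx

theorem IsSolution.hasDerivAt_fst (h : IsSolution Λ a k z Φ) {x : ℝ} (hx : x ∈ I Λ a) :
    HasDerivAt Φ.1 (-(q Λ a k x) * Φ.1 x - z * Φ.2 x) x := by
  have h1 := (h.2.2 x hx).2
  simp only [formalU] at h1
  refine ((h.1.differentiableAt (I_mem_nhds hx)).hasDerivAt).congr_deriv ?_
  linear_combination -h1

theorem IsSolution.hasDerivAt_snd (h : IsSolution Λ a k z Φ) {x : ℝ} (hx : x ∈ I Λ a) :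
    HasDerivAt Φ.2 (q Λ a k x * Φ.2 x + z * Φ.1 x) x := by
  have h1 := (h.2.2 x hx).1
  simp only [formalU] at h1
  refine ((h.2.1.differentiableAt (I_mem_nhds hx)).hasDerivAt).congr_deriv ?_
  linear_combination h1

theorem isSolution_of_hasDerivAt
    (h1 : ∀ x ∈ I Λ a, HasDerivAt Φ.1 (-(q Λ a k x) * Φ.1 x - z * Φ.2 x) x)
    (h2 : ∀ x ∈ I Λ a, HasDerivAt Φ.2 (q Λ a k x * Φ.2 x + z * Φ.1 x) x) :
    IsSolution Λ a k z Φ := by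
  refine ⟨fun x hx => (h1 x hx).differentiableAt.differentiableWithinAt,
    fun x hx => (h2 x hx).differentiableAt.differentiableWithinAt, fun x hx => ?_⟩
  simp only [formalU, (h1 x hx).deriv, (h2 x hx).deriv]
  constructor <;> ring

theorem IsSolution.continuousOn_fst (h : IsSolution Λ a k z Φ) : ContinuousOn Φ.1 (I Λ a) :=
  h.1.continuousOn

theorem IsSolution.continuousOn_snd (h : IsSolution Λ a k z Φ) : ContinuousOn Φ.2 (I Λ a) :=
  h.2.1.continuousOn

/-! ### Reflection of solutions -/

/-- The reflection of `I` at its midpoint, exchanging the two components. -/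
noncomputable def reflect (Λ a : ℝ) (Φ : (ℝ → ℂ) × (ℝ → ℂ)) : (ℝ → ℂ) × (ℝ → ℂ) :=
  (fun x => Φ.2 (xEnd Λ a - x), fun x => Φ.1 (xEnd Λ a - x))

theorem reflect_reflect (Λ a : ℝ) (Φ : (ℝ → ℂ) × (ℝ → ℂ)) :
    reflect Λ a (reflect Λ a Φ) = Φ := by
  simp [reflect]

include hΛ in
-- Reflection preserves `q` and reverses `d/dx`; exchanging the components restores the signs.
theorem IsSolution.reflect (h : IsSolution Λ a k z Φ) :
    IsSolution Λ a k z (reflect Λ a Φ) := by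
  refine isSolution_of_hasDerivAt (fun x hx => ?_) fun x hx => ?_
  · refine (HasDerivAt.comp_const_sub _ x
      (h.hasDerivAt_snd (reflect_mem a hx))).congr_deriv ?_
    rw [q_reflect hΛ a k hx]
    simp only [KerrDeSitter.reflect]
    ring
  · refine (HasDerivAt.comp_const_sub _ x
      (h.hasDerivAt_fst (reflect_mem a hx))).congr_deriv ?_
    rw [q_reflect hΛ a k hx]
    simp only [KerrDeSitter.reflect]
    ring

theorem measurePreserving_reflect (L c : ℝ) :
    MeasurePreserving (fun x => L - x) (volume.restrict (Ioo (L - c) L))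
      (volume.restrict (Ioo 0 c)) := by
  have h := (Measure.measurePreserving_sub_left volume L).restrict_preimage
    (s := Ioo 0 c) measurableSet_Ioo
  rwa [preimage_const_sub_Ioo, sub_zero] at h

theorem measurePreserving_reflect' (L c : ℝ) :
    MeasurePreserving (fun x => L - x) (volume.restrict (Ioo 0 (L - c)))
      (volume.restrict (Ioo c L)) := by
  have h := (Measure.measurePreserving_sub_left volume L).restrict_preimage
    (s := Ioo c L) measurableSet_Ioo
  rwa [preimage_const_sub_Ioo, sub_self] at h

theorem LiesLeft.reflect (h : LiesLeft Λ a Φ) : LiesRight Λ a (reflect Λ a Φ) := by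
  obtain ⟨c, hc, h1, h2⟩ := h
  exact ⟨xEnd Λ a - c, reflect_mem a hc, h2.comp_measurePreserving (measurePreserving_reflect _ _),
    h1.comp_measurePreserving (measurePreserving_reflect _ _)⟩

theorem LiesRight.reflect (h : LiesRight Λ a Φ) : LiesLeft Λ a (reflect Λ a Φ) := by
  obtain ⟨c, hc, h1, h2⟩ := h
  exact ⟨xEnd Λ a - c, reflect_mem a hc, h2.comp_measurePreserving (measurePreserving_reflect' _ _),
    h1.comp_measurePreserving (measurePreserving_reflect' _ _)⟩

include hΛ

theorem IsLimitPoint.right (h : IsLimitPoint Λ a k (LiesLeft Λ a)) :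
    IsLimitPoint Λ a k (LiesRight Λ a) := fun z => by
  obtain ⟨Φ, h1, h2⟩ := h z
  exact ⟨KerrDeSitter.reflect Λ a Φ, h1.reflect hΛ, fun h => h2 (reflect_reflect Λ a Φ ▸ h.reflect)⟩

theorem IsLimitCircle.right (h : IsLimitCircle Λ a k (LiesLeft Λ a)) :
    IsLimitCircle Λ a k (LiesRight Λ a) := fun z Φ hΦ =>
  reflect_reflect Λ a Φ ▸ (h z _ (hΦ.reflect hΛ)).reflect

/-! ### Existence of solutions -/

theorem exists_isSolution (a k : ℝ) (z : ℂ) {x₀ : ℝ} (hx₀ : x₀ ∈ I Λ a) (y : ℂ × ℂ) :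
    ∃ Φ, IsSolution Λ a k z Φ ∧ Φ.1 x₀ = y.1 ∧ Φ.2 x₀ = y.2 := by
  let f := ContinuousLinearMap.fst ℝ ℂ ℂ
  let s := ContinuousLinearMap.snd ℝ ℂ ℂ
  -- The coefficient matrix is `q` times `diag(-1, 1)` plus `z` times a quarter turn.
  have hA : ContinuousOn (fun x => q Λ a k x • (-f).prod s + (-(z • s)).prod (z • f))
      (Ioo 0 (xEnd Λ a)) :=
    ((continuousOn_q hΛ a k).smul continuousOn_const).add continuousOn_const
  obtain ⟨Y, hY0, hY⟩ := exists_hasDerivAt_linear hA hx₀ y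
  refine ⟨(fun x => (Y x).1, fun x => (Y x).2), isSolution_of_hasDerivAt (fun x hx => ?_)
    fun x hx => ?_, by simp [hY0], by simp [hY0]⟩
  · refine (f.hasFDerivAt.comp_hasDerivAt x (hY x hx)).congr_deriv ?_
    simp [f, s]
    ring
  · refine (s.hasFDerivAt.comp_hasDerivAt x (hY x hx)).congr_deriv ?_
    simp [f, s]

/-! ### Behaviour of solutions at the left endpoint -/

theorem IsSolution.hasDerivAt_weight_mul_fst (h : IsSolution Λ a k z Φ) {x : ℝ} (hx : x ∈ I Λ a) :
    HasDerivAt (fun x => (weight Λ a (k + 1 / 2) x : ℂ) * Φ.1 x)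
      (-z * (weight Λ a (k + 1 / 2) x * Φ.2 x)) x := by
  refine ((hasDerivAt_weight hΛ a (k + 1 / 2) hx).ofReal_comp.mul
    (h.hasDerivAt_fst hx)).congr_deriv ?_
  rw [q_eq]
  push_cast
  ring

theorem IsSolution.hasDerivAt_weight_mul_snd (h : IsSolution Λ a k z Φ) {x : ℝ} (hx : x ∈ I Λ a) :
    HasDerivAt (fun x => (weight Λ a (-(k + 1 / 2)) x : ℂ) * Φ.2 x)
      (z * (weight Λ a (-(k + 1 / 2)) x * Φ.1 x)) x := by
  refine ((hasDerivAt_weight hΛ a (-(k + 1 / 2)) hx).ofReal_comp.mul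
    (h.hasDerivAt_snd hx)).congr_deriv ?_
  rw [q_eq]
  push_cast
  ring

theorem LiesLeft.exists_le_xMid (h : LiesLeft Λ a Φ) : ∃ c ∈ Ioc 0 (xMid Λ a),
    MemLp Φ.1 2 (volume.restrict (Ioo 0 c)) ∧ MemLp Φ.2 2 (volume.restrict (Ioo 0 c)) := by
  obtain ⟨c, hc, h1, h2⟩ := h
  have hle : volume.restrict (Ioo 0 (min c (xMid Λ a))) ≤ volume.restrict (Ioo 0 c) :=
    Measure.restrict_mono (Ioo_subset_Ioo_right (min_le_left _ _)) le_rfl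
  exact ⟨min c (xMid Λ a), ⟨lt_min hc.1 (xMid_mem hΛ a).1, min_le_right _ _⟩,
    h1.mono_measure hle, h2.mono_measure hle⟩

theorem Ioc_subset_I {c : ℝ} (hc : c ∈ Ioc 0 (xMid Λ a)) : Ioc 0 c ⊆ I Λ a := fun _ hx =>
  ⟨hx.1, (hx.2.trans hc.2).trans_lt (xMid_mem hΛ a).2⟩

theorem not_memLp_weight {κ c : ℝ} (hκ : 1 / 2 ≤ κ) (hc : c ∈ Ioc 0 (xMid Λ a)) :
    ∀ c' ∈ Ioc 0 c, ¬ MemLp (fun x => (weight Λ a κ x)⁻¹) 2 (volume.restrict (Ioo 0 c')) := by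
  intro c' hc' h
  simp_rw [← weight_neg] at h
  have := (memLp_weight_iff hΛ a (-κ) ⟨hc'.1, hc'.2.trans hc.2⟩).1 h
  linarith

/-- Here `κ ≥ 1/2`, so `weight κ` is increasing with an inverse that is not square integrable at
`0`: both endpoint estimates apply. For `k ≤ -1` the components exchange roles. -/
theorem IsSolution.left_of_nonneg (hk : 0 ≤ k) (h : IsSolution Λ a k z Φ) (hL : LiesLeft Λ a Φ) :
    Tendsto Φ.1 (𝓝[>] 0) (𝓝 0) ∧ IsBoundedUnder (· ≤ ·) (𝓝[>] 0) fun x => ‖Φ.2 x‖ := by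
  obtain ⟨c, hc, h1, h2⟩ := hL.exists_le_xMid hΛ
  have hsub := Ioc_subset_I hΛ hc
  have hκ : 1 / 2 ≤ k + 1 / 2 := by linarith
  have hm : MonotoneOn (weight Λ a (k + 1 / 2)) (Ioc 0 c) :=
    (monotoneOn_weight hΛ a (by linarith)).mono hsub
  have hw := (continuousOn_weight hΛ a (k + 1 / 2)).mono hsub
  refine ⟨tendsto_zero_of_weighted_ode hc.1 (fun x _ => weight_pos _ _ _ _) hm hw
    (h.continuousOn_snd.mono hsub) (fun x hx => h.hasDerivAt_weight_mul_fst hΛ (hsub hx)) h1 h2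
    (not_memLp_weight hΛ hκ hc), ?_⟩
  obtain ⟨C, hC⟩ := bounded_of_weighted_ode (v := Φ.2) (z := z) hc.1
    (fun x _ => weight_pos _ _ _ _) hm hw (h.continuousOn_fst.mono hsub) (fun x hx => by
      simp_rw [← weight_neg]
      exact h.hasDerivAt_weight_mul_snd hΛ (hsub hx)) h1
  exact ⟨C, eventually_map.2 (mem_of_superset (Ioc_mem_nhdsGT hc.1) hC)⟩

theorem IsSolution.left_of_le_neg_one (hk : k ≤ -1) (h : IsSolution Λ a k z Φ)
    (hL : LiesLeft Λ a Φ) :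
    Tendsto Φ.2 (𝓝[>] 0) (𝓝 0) ∧ IsBoundedUnder (· ≤ ·) (𝓝[>] 0) fun x => ‖Φ.1 x‖ := by
  obtain ⟨c, hc, h1, h2⟩ := hL.exists_le_xMid hΛ
  have hsub := Ioc_subset_I hΛ hc
  have hκ : 1 / 2 ≤ -(k + 1 / 2) := by linarith
  have hm : MonotoneOn (weight Λ a (-(k + 1 / 2))) (Ioc 0 c) :=
    (monotoneOn_weight hΛ a (by linarith)).mono hsub
  have hw := (continuousOn_weight hΛ a (-(k + 1 / 2))).mono hsub
  refine ⟨tendsto_zero_of_weighted_ode hc.1 (fun x _ => weight_pos _ _ _ _) hm hw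
    (h.continuousOn_fst.mono hsub) (fun x hx => h.hasDerivAt_weight_mul_snd hΛ (hsub hx)) h2 h1
    (not_memLp_weight hΛ hκ hc), ?_⟩
  obtain ⟨C, hC⟩ := bounded_of_weighted_ode (v := Φ.1) (z := -z) hc.1
    (fun x _ => weight_pos _ _ _ _) hm hw (h.continuousOn_snd.mono hsub) (fun x hx => by
      simp_rw [← weight_neg, neg_neg]
      exact h.hasDerivAt_weight_mul_fst hΛ (hsub hx)) h2
  exact ⟨C, eventually_map.2 (mem_of_superset (Ioc_mem_nhdsGT hc.1) hC)⟩

/-- The boundary terms of both the Wronskian and the Lagrange identity are controlled by such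
products; one factor tends to `0` and the other stays bounded. -/
theorem tendsto_mul_left (hk : k ∉ Ioo (-1 : ℝ) 0) {w : ℂ} (hΦ : IsSolution Λ a k z Φ)
    (hΨ : IsSolution Λ a k w Ψ) (hΦL : LiesLeft Λ a Φ) (hΨL : LiesLeft Λ a Ψ) :
    Tendsto (fun x => Φ.1 x * Ψ.2 x) (𝓝[>] 0) (𝓝 0) := by
  by_cases h0 : 0 ≤ k
  · exact (hΦ.left_of_nonneg hΛ h0 hΦL).1.zero_mul_isBoundedUnder_le
      (hΨ.left_of_nonneg hΛ h0 hΨL).2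
  · have h1 : k ≤ -1 := by
      by_contra h
      exact hk ⟨lt_of_not_ge h, lt_of_not_ge h0⟩
    exact isBoundedUnder_le_mul_tendsto_zero (hΦ.left_of_le_neg_one hΛ h1 hΦL).2
      (hΨ.left_of_le_neg_one hΛ h1 hΨL).1

/-! ### The limit point case -/

omit hΛ in
-- The coefficient matrix of the system has trace zero.
theorem wronskian_eq (hΦ : IsSolution Λ a k z Φ) (hΨ : IsSolution Λ a k z Ψ) {x y : ℝ}
    (hx : x ∈ I Λ a) (hy : y ∈ I Λ a) :
    Φ.1 x * Ψ.2 x - Ψ.1 x * Φ.2 x = Φ.1 y * Ψ.2 y - Ψ.1 y * Φ.2 y := by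
  have hd : ∀ x ∈ Ioo 0 (xEnd Λ a),
      HasDerivAt (fun x => Φ.1 x * Ψ.2 x - Ψ.1 x * Φ.2 x) 0 x := fun x hx => by
    refine (((hΦ.hasDerivAt_fst hx).mul (hΨ.hasDerivAt_snd hx)).sub
      ((hΨ.hasDerivAt_fst hx).mul (hΦ.hasDerivAt_snd hx))).congr_deriv ?_
    ring
  exact isOpen_Ioo.is_const_of_deriv_eq_zero isPreconnected_Ioo
    (fun x hx => (hd x hx).differentiableAt.differentiableWithinAt) (fun x hx => (hd x hx).deriv)
    hx hy

/-- If both solutions of a fundamental system were square integrable near `0`, their Wronskian,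
constantly `1`, would tend to `0`. -/
theorem isLimitPoint_left (hk : k ∉ Ioo (-1 : ℝ) 0) : IsLimitPoint Λ a k (LiesLeft Λ a) := by
  intro z
  have hm := xMid_mem hΛ a
  obtain ⟨Φ, hΦ, hΦ1, hΦ2⟩ := exists_isSolution hΛ a k z hm (1, 0)
  obtain ⟨Ψ, hΨ, hΨ1, hΨ2⟩ := exists_isSolution hΛ a k z hm (0, 1)
  by_contra! hcon
  have h1 := (tendsto_mul_left hΛ hk hΦ hΨ (hcon Φ hΦ) (hcon Ψ hΨ)).sub
    (tendsto_mul_left hΛ hk hΨ hΦ (hcon Ψ hΨ) (hcon Φ hΦ))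
  have h2 : Tendsto (fun x => Φ.1 x * Ψ.2 x - Ψ.1 x * Φ.2 x) (𝓝[>] 0) (𝓝 1) := by
    refine tendsto_const_nhds.congr' ?_
    filter_upwards [Ioo_mem_nhdsGT (xEnd_pos hΛ a)] with x hx
    rw [wronskian_eq hΦ hΨ hx hm, hΦ1, hΦ2, hΨ1, hΨ2]
    norm_num
  have := tendsto_nhds_unique h2 h1
  norm_num at this

/-! ### The limit circle case -/

/-- A Gronwall argument running towards `0`: `N = |W Φ₁|² + |V Φ₂|²` satisfies `N' ≥ -‖z‖ p N`, and
`p = W² + V²` is integrable at `0` because `|κ| < 1/2`. Hence `N` times the exponential of `‖z‖ ∫ p`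
is increasing. -/
theorem IsSolution.bounded_of_limitCircle (hk : k ∈ Ioo (-1 : ℝ) 0) (h : IsSolution Λ a k z Φ) :
    ∃ B, ∀ x ∈ Ioo 0 (xMid Λ a), ‖(weight Λ a (k + 1 / 2) x : ℂ) * Φ.1 x‖ ≤ B ∧
      ‖(weight Λ a (-(k + 1 / 2)) x : ℂ) * Φ.2 x‖ ≤ B := by
  set W := weight Λ a (k + 1 / 2) with hW
  set V := weight Λ a (-(k + 1 / 2)) with hV
  have hVW : ∀ x, V x = (W x)⁻¹ := fun x => weight_neg _ _ _ _
  have hWpos : ∀ x, 0 < W x := fun x => weight_pos _ _ _ _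
  have hmid := xMid_mem hΛ a
  have hmm : xMid Λ a ∈ Ioc 0 (xMid Λ a) := ⟨hmid.1, le_rfl⟩
  set p : ℝ → ℝ := fun x => W x ^ 2 + V x ^ 2 with hp
  have hpc : ContinuousOn p (Ioo 0 (xEnd Λ a)) :=
    ((continuousOn_weight hΛ a _).pow 2).add ((continuousOn_weight hΛ a _).pow 2)
  have hpi : IntervalIntegrable p volume 0 (xMid Λ a) := by
    rw [intervalIntegrable_iff_integrableOn_Ioo_of_le hmid.1.le]
    exact ((memLp_weight_iff hΛ a _ hmm).2 (by linarith [hk.1])).integrable_sq.add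
      ((memLp_weight_iff hΛ a _ hmm).2 (by linarith [hk.2])).integrable_sq
  set N : ℝ → ℝ := fun x => ‖(W x : ℂ) * Φ.1 x‖ ^ 2 + ‖(V x : ℂ) * Φ.2 x‖ ^ 2 with hN
  set G : ℝ → ℝ := fun x => N x * Real.exp (‖z‖ * ∫ t in (xMid Λ a)..x, p t) with hG
  have hGd : ∀ x ∈ Ioo 0 (xEnd Λ a), ∃ G', HasDerivAt G G' x ∧ 0 ≤ G' := by
    intro x hx
    have hM := hasDerivAt_integral_of_continuousOn_Ioo hpc hmid hx
    refine ⟨_, (((h.hasDerivAt_weight_mul_fst hΛ hx).norm_sq).add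
      ((h.hasDerivAt_weight_mul_snd hΛ hx).norm_sq)).mul (hM.const_mul ‖z‖).exp, ?_⟩
    simp only [Pi.add_apply]
    rw [← hW, ← hV]
    -- As `V W = 1`, the factor `W Φ₂` equals `W² (V Φ₂)`.
    have e1 : |inner ℝ ((W x : ℂ) * Φ.1 x) (-z * (W x * Φ.2 x))| ≤
        ‖z‖ * W x ^ 2 * (‖(W x : ℂ) * Φ.1 x‖ * ‖(V x : ℂ) * Φ.2 x‖) := by
      refine (abs_real_inner_le_norm _ _).trans_eq ?_
      simp only [norm_mul, norm_neg, Complex.norm_real, hVW, norm_inv,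
        Real.norm_of_nonneg (hWpos x).le]
      have := (hWpos x).ne'
      field_simp
    have e2 : |inner ℝ ((V x : ℂ) * Φ.2 x) (z * (V x * Φ.1 x))| ≤
        ‖z‖ * V x ^ 2 * (‖(W x : ℂ) * Φ.1 x‖ * ‖(V x : ℂ) * Φ.2 x‖) := by
      refine (abs_real_inner_le_norm _ _).trans_eq ?_
      simp only [norm_mul, Complex.norm_real, hVW, norm_inv,
        Real.norm_of_nonneg (hWpos x).le]
      have := (hWpos x).ne'
      field_simp
    have e3 := (abs_le.1 e1).1
    have e4 := (abs_le.1 e2).1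
    have e5 := two_mul_le_add_sq ‖(W x : ℂ) * Φ.1 x‖ ‖(V x : ℂ) * Φ.2 x‖
    have e6 : 0 ≤ ‖z‖ * (W x ^ 2 + V x ^ 2) := by positivity
    have e7 := mul_le_mul_of_nonneg_left e5 e6
    set E := Real.exp (‖z‖ * ∫ t in (xMid Λ a)..x, p t)
    have hE : 0 < E := Real.exp_pos _
    have : 0 ≤ (2 * inner ℝ ((W x : ℂ) * Φ.1 x) (-z * (W x * Φ.2 x)) +
        2 * inner ℝ ((V x : ℂ) * Φ.2 x) (z * (V x * Φ.1 x)) +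
        (‖(W x : ℂ) * Φ.1 x‖ ^ 2 + ‖(V x : ℂ) * Φ.2 x‖ ^ 2) * (‖z‖ * p x)) * E := by
      refine mul_nonneg ?_ hE.le
      simp only [hp]
      linarith
    refine this.trans_eq ?_
    ring
  have hmono : MonotoneOn G (Ioo 0 (xEnd Λ a)) := by
    refine monotoneOn_of_deriv_nonneg (convex_Ioo _ _) (fun x hx => ?_) ?_ ?_
    · obtain ⟨G', hG', -⟩ := hGd x hx
      exact hG'.continuousAt.continuousWithinAt
    · rw [interior_Ioo]
      intro x hx
      obtain ⟨G', hG', -⟩ := hGd x hx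
      exact hG'.differentiableAt.differentiableWithinAt
    · rw [interior_Ioo]
      intro x hx
      obtain ⟨G', hG', h0⟩ := hGd x hx
      rwa [hG'.deriv]
  have hNb : ∀ x ∈ Ioo 0 (xMid Λ a),
      N x ≤ N (xMid Λ a) * Real.exp (‖z‖ * ∫ t in (0 : ℝ)..(xMid Λ a), p t) := by
    intro x hx
    have h1 : G x ≤ G (xMid Λ a) := hmono ⟨hx.1, hx.2.trans hmid.2⟩ hmid hx.2.le
    simp only [hG, intervalIntegral.integral_same, mul_zero, Real.exp_zero, mul_one] at h1
    have h2 : ∫ t in x..(xMid Λ a), p t ≤ ∫ t in (0 : ℝ)..(xMid Λ a), p t :=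
      intervalIntegral.integral_mono_interval hx.1.le hx.2.le le_rfl
        (Eventually.of_forall fun t => by positivity) hpi
    rw [intervalIntegral.integral_symm, mul_neg, Real.exp_neg, ← div_eq_mul_inv,
      div_le_iff₀ (Real.exp_pos _)] at h1
    have hN0 : 0 ≤ N (xMid Λ a) := by positivity
    refine h1.trans ?_
    gcongr
  refine ⟨√(N (xMid Λ a) * Real.exp (‖z‖ * ∫ t in (0 : ℝ)..(xMid Λ a), p t)), fun x hx => ?_⟩
  have hx' := hNb x hx
  constructor <;> refine Real.le_sqrt_of_sq_le (le_trans ?_ hx')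
  · exact le_add_of_nonneg_right (by positivity)
  · exact le_add_of_nonneg_left (by positivity)

/-- By the bound on the weighted components, `Φ₁` is `O(weight (-κ))` and `Φ₂` is `O(weight κ)` at
`0`, both square integrable. -/
theorem isLimitCircle_left (hk : k ∈ Ioo (-1 : ℝ) 0) : IsLimitCircle Λ a k (LiesLeft Λ a) := by
  intro z Φ h
  have hmid := xMid_mem hΛ a
  have hmm : xMid Λ a ∈ Ioc 0 (xMid Λ a) := ⟨hmid.1, le_rfl⟩
  have hsub : Ioo 0 (xMid Λ a) ⊆ I Λ a := Ioo_subset_Ioo_right hmid.2.le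
  obtain ⟨B, hB⟩ := h.bounded_of_limitCircle hΛ hk
  have key : ∀ (κ : ℝ) (f : ℝ → ℂ), -1 / 2 < -κ → ContinuousOn f (I Λ a) →
      (∀ x ∈ Ioo 0 (xMid Λ a), ‖(weight Λ a κ x : ℂ) * f x‖ ≤ B) →
      MemLp f 2 (volume.restrict (Ioo 0 (xMid Λ a))) := by
    intro κ f hκ hf hb
    refine (((memLp_weight_iff hΛ a (-κ) hmm).2 hκ).const_mul B).mono
      ((hf.mono hsub).aestronglyMeasurable measurableSet_Ioo) ?_
    filter_upwards [ae_restrict_mem measurableSet_Ioo] with x hx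
    have hw := weight_pos Λ a κ x
    have h1 := hb x hx
    rw [norm_mul, Complex.norm_real, Real.norm_of_nonneg hw.le] at h1
    refine le_trans ?_ (Real.le_norm_self _)
    rw [weight_neg, ← div_eq_mul_inv, le_div_iff₀ hw, mul_comm]
    exact h1
  exact ⟨xMid Λ a, hmid, key _ _ (by linarith [hk.2]) h.continuousOn_fst fun x hx => (hB x hx).1,
    key _ _ (by linarith [hk.1]) h.continuousOn_snd fun x hx => (hB x hx).2⟩

end KerrDeSitter

/-! ### The minimal operator and its adjoint. -/

namespace KerrDeSitter

open Filter Topology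
open scoped ComplexConjugate ContDiff

variable {Λ : ℝ} (hΛ : 0 ≤ Λ) {a k : ℝ} {z : ℂ}

/-- The element of `L²(I, dx)²` given by two square integrable functions. -/
noncomputable def toH {f₁ f₂ : ℝ → ℂ} (h₁ : MemLp f₁ 2 (mu Λ a)) (h₂ : MemLp f₂ 2 (mu Λ a)) :
    H Λ a :=
  WithLp.toLp 2 (h₁.toLp f₁, h₂.toLp f₂)

theorem inner_toLp {f g : ℝ → ℂ} (hf : MemLp f 2 (mu Λ a)) (hg : MemLp g 2 (mu Λ a)) :
    inner ℂ (hf.toLp f) (hg.toLp g) = ∫ x, conj (f x) * g x ∂(mu Λ a) := by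
  rw [L2.inner_def]
  refine integral_congr_ae ?_
  filter_upwards [hf.coeFn_toLp, hg.coeFn_toLp] with x h1 h2
  rw [h1, h2, RCLike.inner_apply, mul_comm]

theorem inner_toH {f₁ f₂ g₁ g₂ : ℝ → ℂ} (hf₁ : MemLp f₁ 2 (mu Λ a)) (hf₂ : MemLp f₂ 2 (mu Λ a))
    (hg₁ : MemLp g₁ 2 (mu Λ a)) (hg₂ : MemLp g₂ 2 (mu Λ a)) :
    inner ℂ (toH hf₁ hf₂) (toH hg₁ hg₂) =
      (∫ x, conj (f₁ x) * g₁ x ∂(mu Λ a)) + ∫ x, conj (f₂ x) * g₂ x ∂(mu Λ a) := by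
  rw [WithLp.prod_inner_apply, ← inner_toLp hf₁ hg₁, ← inner_toLp hf₂ hg₂]
  rfl

theorem memLp_fst (F : H Λ a) : MemLp (F.fst : ℝ → ℂ) 2 (mu Λ a) := Lp.memLp _

theorem memLp_snd (F : H Λ a) : MemLp (F.snd : ℝ → ℂ) 2 (mu Λ a) := Lp.memLp _

theorem toH_eta (F : H Λ a) : toH (memLp_fst F) (memLp_snd F) = F := by
  refine congrArg (WithLp.toLp 2) (Prod.ext ?_ ?_)
  · exact Lp.toLp_coeFn F.fst (memLp_fst F)
  · exact Lp.toLp_coeFn F.snd (memLp_snd F)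

theorem smul_toH {f₁ f₂ : ℝ → ℂ} (h₁ : MemLp f₁ 2 (mu Λ a)) (h₂ : MemLp f₂ 2 (mu Λ a)) (z : ℂ) :
    z • toH h₁ h₂ = toH (h₁.const_smul z) (h₂.const_smul z) := rfl

theorem adjPair_iff {F G : H Λ a} : LinearPMap.AdjPair (minOp hΛ a k) F G ↔
    ∀ φ : TestPair Λ a, inner ℂ G (incl Λ a φ) = inner ℂ F (applyU hΛ a k φ) := by
  constructor
  · intro h φ
    have := h ⟨incl Λ a φ, φ, rfl⟩
    rwa [minOp_apply] at this
  · rintro h ⟨_, φ, rfl⟩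
    have := h φ
    rwa [← minOp_apply] at this

theorem _root_.MeasureTheory.MemLp.integrable_conj_mul {μ : Measure ℝ} {f g : ℝ → ℂ} (hf : MemLp f 2 μ)
    (hg : MemLp g 2 μ) : Integrable (fun x => conj (f x) * g x) μ :=
  MemLp.integrable_mul hf.star hg

/-- The integrand is the derivative of the compactly supported function `f^* φ`. -/
theorem integral_conj_mul_test_eq_zero {f f' : ℝ → ℂ} (hf : ∀ x ∈ I Λ a, HasDerivAt f (f' x) x)
    (φ : 𝓓(I Λ a, ℂ))
    (hi : Integrable (fun x => conj (f' x) * φ x + conj (f x) * deriv φ x) (mu Λ a)) :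
    ∫ x, (conj (f' x) * φ x + conj (f x) * deriv φ x) ∂(mu Λ a) = 0 := by
  have hφ0 : ∀ x ∉ (I Λ a : Set ℝ), φ =ᶠ[𝓝 x] 0 := fun x hx =>
    notMem_tsupport_iff_eventuallyEq.1 fun h => hx (φ.tsupport_subset h)
  have hzero : ∀ x ∉ (I Λ a : Set ℝ), conj (f' x) * φ x + conj (f x) * deriv φ x = 0 := by
    intro x hx
    rw [(hφ0 x hx).deriv_eq, (hφ0 x hx).eq_of_nhds]
    simp
  -- Nothing is known of `f` outside `I`, but `φ` vanishes in a neighbourhood of every point there.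
  have hd : ∀ x, HasDerivAt (fun x => conj (f x) * φ x)
      (conj (f' x) * φ x + conj (f x) * deriv φ x) x := by
    intro x
    by_cases hx : x ∈ (I Λ a : Set ℝ)
    · exact (hf x hx).star.mul (differentiable_test φ x).hasDerivAt
    · rw [hzero x hx]
      refine (hasDerivAt_const x (0 : ℂ)).congr_of_eventuallyEq ?_
      filter_upwards [hφ0 x hx] with y hy
      simp [hy]
  rw [setIntegral_eq_integral_of_forall_compl_eq_zero hzero]
  refine integral_eq_zero_of_hasDerivAt_of_integrable hd ?_ ?_
  · exact (integrableOn_iff_integrable_of_support_subset fun x hx => by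
      by_contra h; exact hx (hzero x h)).1 hi
  · refine Continuous.integrable_of_hasCompactSupport ?_ φ.hasCompactSupport.mul_left
    exact continuous_iff_continuousAt.2 fun x => (hd x).continuousAt

theorem incl_eq_toH (φ : TestPair Λ a) : incl Λ a φ = toH (memLp_test φ.1) (memLp_test φ.2) := rfl

theorem applyU_eq_toH (φ : TestPair Λ a) :
    applyU hΛ a k φ = toH (memLp_formalU_fst hΛ a k φ) (memLp_formalU_snd hΛ a k φ) := rfl

/-- Differentiable functions whose image under the formal operator is square integrable belong to
the domain of the adjoint. -/
theorem adjPair_of_hasDerivAt {f₁ f₂ f₁' f₂' g₁ g₂ : ℝ → ℂ}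
    (hf₁ : MemLp f₁ 2 (mu Λ a)) (hf₂ : MemLp f₂ 2 (mu Λ a))
    (hg₁ : MemLp g₁ 2 (mu Λ a)) (hg₂ : MemLp g₂ 2 (mu Λ a))
    (hd₁ : ∀ x ∈ I Λ a, HasDerivAt f₁ (f₁' x) x) (hd₂ : ∀ x ∈ I Λ a, HasDerivAt f₂ (f₂' x) x)
    (h₁ : ∀ x ∈ I Λ a, g₁ x = f₂' x - q Λ a k x * f₂ x)
    (h₂ : ∀ x ∈ I Λ a, g₂ x = -f₁' x - q Λ a k x * f₁ x) :
    LinearPMap.AdjPair (minOp hΛ a k) (toH hf₁ hf₂) (toH hg₁ hg₂) := by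
  rw [adjPair_iff]
  intro φ
  rw [incl_eq_toH, applyU_eq_toH, inner_toH, inner_toH]
  have hi1 := hg₁.integrable_conj_mul (memLp_test φ.1)
  have hi2 := hg₂.integrable_conj_mul (memLp_test φ.2)
  have hi3 := hf₁.integrable_conj_mul (memLp_formalU_fst hΛ a k φ)
  have hi4 := hf₂.integrable_conj_mul (memLp_formalU_snd hΛ a k φ)
  have hmem : ∀ᵐ x ∂(mu Λ a), x ∈ I Λ a := ae_restrict_mem (I Λ a).2.measurableSet
  have ha : (fun x => conj (f₂' x) * φ.1 x + conj (f₂ x) * deriv φ.1 x) =ᵐ[mu Λ a]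
      fun x => conj (g₁ x) * φ.1 x - conj (f₂ x) * (formalU Λ a k (φ.1, φ.2)).2 x := by
    filter_upwards [hmem] with x hx
    simp only [formalU, h₁ x hx, map_sub, map_mul, Complex.conj_ofReal]
    ring
  have hb : (fun x => conj (f₁' x) * φ.2 x + conj (f₁ x) * deriv φ.2 x) =ᵐ[mu Λ a]
      fun x => conj (f₁ x) * (formalU Λ a k (φ.1, φ.2)).1 x - conj (g₂ x) * φ.2 x := by
    filter_upwards [hmem] with x hx
    simp only [formalU, h₂ x hx, map_sub, map_mul, map_neg, Complex.conj_ofReal]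
    ring
  have ea := integral_conj_mul_test_eq_zero hd₂ φ.1 ((hi1.sub hi4).congr ha.symm)
  have eb := integral_conj_mul_test_eq_zero hd₁ φ.2 ((hi3.sub hi2).congr hb.symm)
  rw [integral_congr_ae ha, integral_sub hi1 hi4] at ea
  rw [integral_congr_ae hb, integral_sub hi3 hi2] at eb
  linear_combination ea - eb

theorem minOp_symmetric (a k : ℝ) : (minOp hΛ a k).IsFormalAdjoint (minOp hΛ a k) := by
  rintro ⟨_, φ, rfl⟩ y
  rw [minOp_apply]
  exact adjPair_of_hasDerivAt hΛ (memLp_test φ.1) (memLp_test φ.2) (memLp_formalU_fst hΛ a k φ)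
    (memLp_formalU_snd hΛ a k φ) (fun x _ => (differentiable_test φ.1 x).hasDerivAt)
    (fun x _ => (differentiable_test φ.2 x).hasDerivAt) (fun _ _ => rfl) (fun _ _ => rfl) y

/-- The complex-valued test function given by a real-valued one. -/
noncomputable def testOfReal {φ : ℝ → ℝ} (h : ContDiff ℝ ∞ φ) (hc : HasCompactSupport φ)
    (hs : tsupport φ ⊆ I Λ a) : 𝓓(I Λ a, ℂ) where
  toFun x := φ x
  contDiff' := Complex.ofRealCLM.contDiff.comp h
  hasCompactSupport' := hc.comp_left Complex.ofReal_zero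
  tsupport_subset' := by
    refine (closure_mono (t := Function.support φ) fun x hx => ?_).trans hs
    simpa using hx

theorem testOfReal_apply {φ : ℝ → ℝ} (h : ContDiff ℝ ∞ φ) (hc : HasCompactSupport φ)
    (hs : tsupport φ ⊆ I Λ a) (x : ℝ) : testOfReal h hc hs x = φ x := rfl

theorem deriv_testOfReal {φ : ℝ → ℝ} (h : ContDiff ℝ ∞ φ) (hc : HasCompactSupport φ)
    (hs : tsupport φ ⊆ I Λ a) (x : ℝ) : deriv (testOfReal h hc hs) x = deriv φ x :=
  ((h.differentiable (by simp) x).hasDerivAt.ofReal_comp).deriv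

theorem memLp_locallyIntegrableOn {f : ℝ → ℂ} (hf : MemLp f 2 (mu Λ a)) :
    LocallyIntegrableOn f (Ioo 0 (xEnd Λ a)) := by
  have : IsFiniteMeasure (mu Λ a) := inferInstanceAs
    (IsFiniteMeasure (volume.restrict (Ioo 0 (xEnd Λ a))))
  have h : Integrable f (mu Λ a) := hf.integrable (by norm_num)
  exact IntegrableOn.locallyIntegrableOn (μ := volume) (s := Ioo 0 (xEnd Λ a)) h

theorem dense_minOp_domain (a k : ℝ) : Dense ((minOp hΛ a k).domain : Set (H Λ a)) := by
  change Dense ((LinearMap.range (incl Λ a) : Submodule ℂ (H Λ a)) : Set (H Λ a))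
  rw [Submodule.dense_iff_topologicalClosure_eq_top, Submodule.topologicalClosure_eq_top_iff,
    Submodule.eq_bot_iff]
  intro F hF
  rw [Submodule.mem_orthogonal'] at hF
  have hF' : ∀ φ : TestPair Λ a, (∫ x, conj (F.fst x) * φ.1 x ∂(mu Λ a)) +
      ∫ x, conj (F.snd x) * φ.2 x ∂(mu Λ a) = 0 := fun φ => by
    rw [← hF _ ⟨φ, rfl⟩, incl_eq_toH, ← inner_toH (memLp_fst F) (memLp_snd F), toH_eta]
  have key : ∀ f : ℝ → ℂ, MemLp f 2 (mu Λ a) →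
      (∀ φ : 𝓓(I Λ a, ℂ), ∫ x, conj (f x) * φ x ∂(mu Λ a) = 0) → f =ᵐ[mu Λ a] 0 := by
    intro f hf h
    have h1 := (I Λ a).2.ae_eq_zero_of_integral_contDiff_smul_eq_zero (μ := volume)
      (f := fun x => conj (f x)) (memLp_locallyIntegrableOn hf.star) fun φ hφ hc hs => by
        rw [← h (testOfReal hφ hc hs), setIntegral_eq_integral_of_forall_compl_eq_zero]
        · simp only [testOfReal_apply, Complex.real_smul, mul_comm]
        · intro x hx
          rw [testOfReal_apply, image_eq_zero_of_notMem_tsupport fun h => hx (hs h)]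
          simp
    refine (ae_restrict_iff' (I Λ a).2.measurableSet).2 ?_
    filter_upwards [h1] with x hx hxI
    simpa using hx hxI
  have e1 := key _ (memLp_fst F) fun φ => by
    have := hF' (φ, 0)
    simpa using this
  have e2 := key _ (memLp_snd F) fun φ => by
    have := hF' (0, φ)
    simpa using this
  exact WithLp.ofLp_injective 2 (Prod.ext ((Lp.eq_zero_iff_ae_eq_zero).2 e1)
    ((Lp.eq_zero_iff_ae_eq_zero).2 e2))

theorem isClosable_minOp (a k : ℝ) : (minOp hΛ a k).IsClosable :=
  LinearPMap.isClosable_of_symmetric (dense_minOp_domain hΛ a k) (minOp_symmetric hΛ a k)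

/-! ### Failure of self-adjointness in the limit circle case -/

/-- The adjoint sends `(weight (-κ), 0)` to `0` and `(0, x · weight κ)` to `(weight κ, 0)`. If it
were symmetric, `∫ weight (-κ) · weight κ`, the length of `I`, would be zero. -/
theorem not_isSelfAdjoint (a : ℝ) (hk : k ∈ Ioo (-1 : ℝ) 0) : ¬ IsSelfAdjoint (Au hΛ a k) := by
  intro hsa
  set κ := k + 1 / 2 with hκ
  have hW : MemLp (fun x => (weight Λ a κ x : ℂ)) 2 (mu Λ a) :=
    (memLp_weight hΛ a (by linarith [hk.1]) (by linarith [hk.2])).ofReal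
  have hV : MemLp (fun x => (weight Λ a (-κ) x : ℂ)) 2 (mu Λ a) :=
    (memLp_weight hΛ a (by linarith [hk.2]) (by linarith [hk.1])).ofReal
  have h0 : MemLp (fun _ : ℝ => (0 : ℂ)) 2 (mu Λ a) := MemLp.zero'
  have hxW : MemLp (fun x : ℝ => (x : ℂ) * (weight Λ a κ x : ℂ)) 2 (mu Λ a) := by
    refine (hW.const_mul (xEnd Λ a : ℂ)).mono
      (Complex.continuous_ofReal.aestronglyMeasurable.mul hW.1) ?_
    filter_upwards [ae_restrict_mem (I Λ a).2.measurableSet] with x hx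
    have hx' : x ∈ Ioo 0 (xEnd Λ a) := hx
    simp only [norm_mul, Complex.norm_real]
    rw [Real.norm_of_nonneg hx'.1.le, Real.norm_of_nonneg (hx'.1.trans hx'.2).le]
    gcongr
    exact hx'.2.le
  have hWd : ∀ (κ : ℝ), ∀ x ∈ I Λ a, HasDerivAt (fun x => (weight Λ a κ x : ℂ))
      ((κ * qUnit Λ a x * weight Λ a κ x : ℝ) : ℂ) x := fun κ x hx =>
    (hasDerivAt_weight hΛ a κ hx).ofReal_comp
  have p1 : LinearPMap.AdjPair (minOp hΛ a k) (toH hV h0) (toH h0 h0) :=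
    adjPair_of_hasDerivAt hΛ hV h0 h0 h0 (hWd (-κ)) (fun x _ => hasDerivAt_const x 0)
      (fun x _ => by ring) fun x _ => by
        rw [q_eq, ← hκ]; push_cast; ring
  have p2 : LinearPMap.AdjPair (minOp hΛ a k) (toH h0 hxW) (toH hW h0) :=
    adjPair_of_hasDerivAt hΛ h0 hxW hW h0 (fun x _ => hasDerivAt_const x 0)
      (fun x hx => Complex.ofRealCLM.hasDerivAt.mul (hWd κ x hx))
      (fun x _ => by simp [q_eq, hκ]; ring) fun x _ => by ring
  have h := p1.inner_eq_of_isSelfAdjoint (isClosable_minOp hΛ a k) hsa p2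
  rw [inner_toH, inner_toH] at h
  have e : ∫ x, conj (weight Λ a (-κ) x : ℂ) * (weight Λ a κ x : ℂ) ∂(mu Λ a) = xEnd Λ a := by
    have : ∀ x, conj (weight Λ a (-κ) x : ℂ) * (weight Λ a κ x : ℂ) = 1 := fun x => by
      rw [Complex.conj_ofReal, weight_neg, Complex.ofReal_inv, inv_mul_cancel₀]
      exact_mod_cast (weight_pos Λ a κ x).ne'
    simp only [this]
    have hv : (volume : Measure ℝ).real (I Λ a : Set ℝ) = xEnd Λ a := by
      change (volume : Measure ℝ).real (Ioo 0 (xEnd Λ a)) = xEnd Λ a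
      rw [Real.volume_real_Ioo_of_le (xEnd_pos hΛ a).le, sub_zero]
    simp [hv]
  rw [e] at h
  simp only [map_zero, zero_mul, mul_zero, integral_zero, add_zero] at h
  exact (xEnd_pos hΛ a).ne' (by exact_mod_cast h.symm)

/-! ### Self-adjointness in the limit point case -/

include hΛ in
/-- Weak solutions of the adjoint eigenvalue equation agree almost everywhere with classical
solutions. -/
theorem exists_isSolution_of_weak {w : ℂ} {u v : ℝ → ℂ} (hu : MemLp u 2 (mu Λ a))
    (hv : MemLp v 2 (mu Λ a))
    (h1 : ∀ φ : ℝ → ℝ, ContDiff ℝ ∞ φ → HasCompactSupport φ → tsupport φ ⊆ I Λ a →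
      ∫ x in Ioo 0 (xEnd Λ a), deriv φ x • u x =
        -∫ x in Ioo 0 (xEnd Λ a), φ x • (-(q Λ a k x) * u x - w * v x))
    (h2 : ∀ φ : ℝ → ℝ, ContDiff ℝ ∞ φ → HasCompactSupport φ → tsupport φ ⊆ I Λ a →
      ∫ x in Ioo 0 (xEnd Λ a), deriv φ x • v x =
        -∫ x in Ioo 0 (xEnd Λ a), φ x • (q Λ a k x * v x + w * u x)) :
    ∃ Φ, IsSolution Λ a k w Φ ∧ u =ᵐ[mu Λ a] Φ.1 ∧ v =ᵐ[mu Λ a] Φ.2 := by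
  have hu' := memLp_locallyIntegrableOn hu
  have hv' := memLp_locallyIntegrableOn hv
  have hq : ContinuousOn (fun x => (q Λ a k x : ℂ)) (Ioo 0 (xEnd Λ a)) :=
    Complex.continuous_ofReal.comp_continuousOn (continuousOn_q hΛ a k)
  have hlc : IsLocallyClosed (Ioo 0 (xEnd Λ a)) := isOpen_Ioo.isLocallyClosed
  have hm := xMid_mem hΛ a
  obtain ⟨c₁, hc₁⟩ := ae_eq_integral_of_weakDeriv hu'
    ((hu'.continuousOn_mul hq.neg hlc).sub (hv'.continuousOn_mul continuousOn_const hlc)) hm h1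
  obtain ⟨c₂, hc₂⟩ := ae_eq_integral_of_weakDeriv hv'
    ((hv'.continuousOn_mul hq hlc).add (hu'.continuousOn_mul continuousOn_const hlc)) hm h2
  set U : ℝ → ℂ := fun x => c₁ + ∫ t in (xMid Λ a)..x, (-(q Λ a k t) * u t - w * v t) with hU
  set V : ℝ → ℂ := fun x => c₂ + ∫ t in (xMid Λ a)..x, (q Λ a k t * v t + w * u t) with hV
  have hUc : ContinuousOn U (Ioo 0 (xEnd Λ a)) :=
    continuousOn_const.add (continuousOn_integral_of_locallyIntegrableOn
      ((hu'.continuousOn_mul hq.neg hlc).sub (hv'.continuousOn_mul continuousOn_const hlc)) hm)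
  have hVc : ContinuousOn V (Ioo 0 (xEnd Λ a)) :=
    continuousOn_const.add (continuousOn_integral_of_locallyIntegrableOn
      ((hv'.continuousOn_mul hq hlc).add (hu'.continuousOn_mul continuousOn_const hlc)) hm)
  have hcongr : ∀ g g' : ℝ → ℂ, (∀ᵐ t, t ∈ Ioo 0 (xEnd Λ a) → g t = g' t) → ∀ x ∈ I Λ a,
      ∫ t in (xMid Λ a)..x, g t = ∫ t in (xMid Λ a)..x, g' t := fun g g' h x hx =>
    intervalIntegral.integral_congr_ae (h.mono fun t ht htm =>
      ht (uIcc_subset_Ioo hm hx (uIoc_subset_uIcc htm)))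
  -- Replacing `u` and `v` by their continuous versions `U` and `V` under the integral makes the
  -- integrand continuous, so `U` is classically differentiable.
  have hU' : ∀ x ∈ I Λ a, HasDerivAt U (-(q Λ a k x) * U x - w * V x) x := fun x hx => by
    refine ((hasDerivAt_integral_of_continuousOn_Ioo ((hq.neg.mul hUc).sub
      (continuousOn_const (c := w).mul hVc)) hm hx).const_add c₁).congr_of_eventuallyEq ?_
    filter_upwards [I_mem_nhds hx] with y hy
    rw [hU]
    refine congrArg (c₁ + ·) (hcongr _ _ ?_ y hy)
    filter_upwards [hc₁, hc₂] with t h1 h2 ht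
    rw [h1 ht, h2 ht]
    rfl
  have hV' : ∀ x ∈ I Λ a, HasDerivAt V (q Λ a k x * V x + w * U x) x := fun x hx => by
    refine ((hasDerivAt_integral_of_continuousOn_Ioo ((hq.mul hVc).add
      (continuousOn_const (c := w).mul hUc)) hm hx).const_add c₂).congr_of_eventuallyEq ?_
    filter_upwards [I_mem_nhds hx] with y hy
    rw [hV]
    refine congrArg (c₂ + ·) (hcongr _ _ ?_ y hy)
    filter_upwards [hc₁, hc₂] with t h1 h2 ht
    rw [h1 ht, h2 ht]
    rfl
  exact ⟨(U, V), isSolution_of_hasDerivAt hU' hV',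
    (ae_restrict_iff' (I Λ a).2.measurableSet).2 hc₁,
    (ae_restrict_iff' (I Λ a).2.measurableSet).2 hc₂⟩

theorem IsSolution.conj {Φ : (ℝ → ℂ) × (ℝ → ℂ)} (h : IsSolution Λ a k z Φ) :
    IsSolution Λ a k (conj z) (fun x => conj (Φ.1 x), fun x => conj (Φ.2 x)) := by
  refine isSolution_of_hasDerivAt (fun x hx => ?_) fun x hx => ?_
  · refine (h.hasDerivAt_fst hx).star.congr_deriv ?_
    simp
  · refine (h.hasDerivAt_snd hx).star.congr_deriv ?_
    simp

theorem integral_eq_neg_integral_of_add_eq_sub {μ : Measure ℝ} {A B D E : ℝ → ℂ}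
    (hA : Integrable A μ) (hB : Integrable B μ) (hD : Integrable D μ)
    (h : ∀ x, D x + E x = A x - B x) (hAB : ∫ x, B x ∂μ = ∫ x, A x ∂μ) :
    ∫ x, D x ∂μ = -∫ x, E x ∂μ := by
  have hE : ∀ x, E x = A x - B x - D x := fun x => by rw [← h]; ring
  simp only [hE]
  have h1 := integral_sub (hA.sub hB) hD
  simp only [Pi.sub_apply] at h1
  rw [h1, integral_sub hA hB, hAB]
  ring

/-- Test pairs with one zero component separate the two equations. The inner product is conjugate
linear in `F`, so the weak system holds for the conjugate of `F` with parameter `conj z`; since `q`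
is real, conjugating back gives a solution for `z`. -/
theorem exists_isSolution_of_adjPair {F : H Λ a} (h : LinearPMap.AdjPair (minOp hΛ a k) F (z • F)) :
    ∃ Φ, IsSolution Λ a k z Φ ∧ F.fst =ᵐ[mu Λ a] Φ.1 ∧ F.snd =ᵐ[mu Λ a] Φ.2 := by
  have hf₁ := memLp_fst F
  have hf₂ := memLp_snd F
  set f₁ : ℝ → ℂ := ⇑F.fst
  set f₂ : ℝ → ℂ := ⇑F.snd
  have hF : F = toH hf₁ hf₂ := (toH_eta F).symm
  have hφ : ∀ φ : TestPair Λ a,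
      (∫ x, conj (z * f₁ x) * φ.1 x ∂(mu Λ a)) + ∫ x, conj (z * f₂ x) * φ.2 x ∂(mu Λ a) =
        (∫ x, conj (f₁ x) * (formalU Λ a k (φ.1, φ.2)).1 x ∂(mu Λ a)) +
        ∫ x, conj (f₂ x) * (formalU Λ a k (φ.1, φ.2)).2 x ∂(mu Λ a) := fun φ => by
    have := (adjPair_iff hΛ).1 h φ
    rwa [hF, smul_toH, incl_eq_toH, applyU_eq_toH, inner_toH, inner_toH] at this
  obtain ⟨Φ, hs, e1, e2⟩ := exists_isSolution_of_weak hΛ (w := conj z) (k := k) hf₁.star hf₂.star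
    (fun φ hφs hc hs => by
      have h1 := hφ (0, testOfReal hφs hc hs)
      simp only [FunLike.coe_zero, Pi.zero_apply, mul_zero, integral_zero, zero_add, formalU,
        deriv_zero, neg_zero, sub_zero, add_zero] at h1
      refine integral_eq_neg_integral_of_add_eq_sub
        (hf₁.integrable_conj_mul (memLp_formalU_fst hΛ a k (0, testOfReal hφs hc hs)))
        ((hf₂.const_mul z).integrable_conj_mul (memLp_test (testOfReal hφs hc hs)))
        ((hf₁.integrable_conj_mul (memLp_deriv_test (testOfReal hφs hc hs))).congr
          (Eventually.of_forall fun x => ?_)) (fun x => ?_) h1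
      · simp only [deriv_testOfReal, Complex.real_smul]
        exact mul_comm _ _
      · simp only [formalU, deriv_testOfReal, testOfReal_apply, Complex.real_smul, Pi.star_apply,
          RCLike.star_def, map_mul]
        ring)
    (fun φ hφs hc hs => by
      have h1 := hφ (testOfReal hφs hc hs, 0)
      simp only [FunLike.coe_zero, Pi.zero_apply, mul_zero, integral_zero, zero_add, formalU,
        deriv_zero, sub_zero, add_zero] at h1
      have h2 : ∫ x, -(conj (z * f₁ x) * testOfReal hφs hc hs x) ∂(mu Λ a) =
          ∫ x, -(conj (f₂ x) * (-deriv (testOfReal hφs hc hs) x -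
            q Λ a k x * testOfReal hφs hc hs x)) ∂(mu Λ a) := by
        rw [integral_neg, integral_neg, h1]
      refine integral_eq_neg_integral_of_add_eq_sub
        (hf₂.integrable_conj_mul (memLp_formalU_snd hΛ a k (testOfReal hφs hc hs, 0))).neg
        ((hf₁.const_mul z).integrable_conj_mul (memLp_test (testOfReal hφs hc hs))).neg
        ((hf₂.integrable_conj_mul (memLp_deriv_test (testOfReal hφs hc hs))).congr
          (Eventually.of_forall fun x => ?_)) (fun x => ?_) h2
      · simp only [deriv_testOfReal, Complex.real_smul]
        exact mul_comm _ _
      · simp only [formalU, deriv_testOfReal, testOfReal_apply, Complex.real_smul, Pi.star_apply,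
          RCLike.star_def, map_mul, Pi.neg_apply]
        ring)
  refine ⟨_, by simpa using hs.conj, ?_, ?_⟩
  · filter_upwards [e1] with x hx
    rw [← hx]; simp
  · filter_upwards [e2] with x hx
    rw [← hx]; simp

include hΛ in
/-- In the limit point case there are no square integrable solutions for non-real `z`. -/
theorem IsSolution.eq_zero_of_memLp (hk : k ∉ Ioo (-1 : ℝ) 0) {Φ : (ℝ → ℂ) × (ℝ → ℂ)}
    (h : IsSolution Λ a k z Φ) (hz : z.im ≠ 0) (h1 : MemLp Φ.1 2 (mu Λ a))
    (h2 : MemLp Φ.2 2 (mu Λ a)) {x : ℝ} (hx : x ∈ I Λ a) : Φ.1 x = 0 ∧ Φ.2 x = 0 := by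
  have hmid := xMid_mem hΛ a
  have hL : LiesLeft Λ a Φ := by
    have hle : volume.restrict (Ioo 0 (xMid Λ a)) ≤ mu Λ a :=
      Measure.restrict_mono (Ioo_subset_Ioo_right hmid.2.le) le_rfl
    exact ⟨_, hmid, h1.mono_measure hle, h2.mono_measure hle⟩
  have hR : LiesRight Λ a Φ := by
    have hle : volume.restrict (Ioo (xMid Λ a) (xEnd Λ a)) ≤ mu Λ a :=
      Measure.restrict_mono (Ioo_subset_Ioo_left hmid.1.le) le_rfl
    exact ⟨_, hmid, h1.mono_measure hle, h2.mono_measure hle⟩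
  -- The Lagrange identity: the derivative of `Im (Φ₂ Φ₁^*)` is `Im z` times `|Φ₁|² + |Φ₂|²`.
  set b : ℝ → ℝ := fun x => (Φ.2 x * conj (Φ.1 x)).im / z.im with hb
  have hbd : ∀ x ∈ Ioo 0 (xEnd Λ a), HasDerivAt b (‖Φ.1 x‖ ^ 2 + ‖Φ.2 x‖ ^ 2) x := by
    intro x hx
    have e := Complex.imCLM.hasFDerivAt.comp_hasDerivAt x
      ((h.hasDerivAt_snd hx).mul (h.hasDerivAt_fst hx).star)
    refine (e.div_const z.im).congr_deriv ?_
    rw [div_eq_iff hz, Complex.imCLM_apply, ← Complex.normSq_eq_norm_sq,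
      ← Complex.normSq_eq_norm_sq, Complex.normSq_apply, Complex.normSq_apply]
    simp
    ring
  have hmono : MonotoneOn b (Ioo 0 (xEnd Λ a)) := by
    refine monotoneOn_of_deriv_nonneg (convex_Ioo _ _)
      (fun x hx => (hbd x hx).continuousAt.continuousWithinAt) ?_ ?_
    · rw [interior_Ioo]
      exact fun x hx => (hbd x hx).differentiableAt.differentiableWithinAt
    · rw [interior_Ioo]
      intro x hx
      rw [(hbd x hx).deriv]
      positivity
  have hbound : ∀ x, ‖b x‖ ≤ ‖Φ.1 x * Φ.2 x‖ / |z.im| := fun x => by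
    rw [hb, Real.norm_eq_abs, abs_div]
    gcongr
    refine (Complex.abs_im_le_norm _).trans_eq ?_
    rw [norm_mul, norm_mul, RCLike.norm_conj, mul_comm]
  have hl : Tendsto b (𝓝[>] 0) (𝓝 0) := by
    refine squeeze_zero_norm hbound ?_
    simpa using (tendsto_mul_left hΛ hk h h hL hL).norm.div_const |z.im|
  have hr : Tendsto (fun x => b (xEnd Λ a - x)) (𝓝[>] 0) (𝓝 0) := by
    refine squeeze_zero_norm (fun x => hbound (xEnd Λ a - x)) ?_
    have := (tendsto_mul_left hΛ hk (h.reflect hΛ) (h.reflect hΛ) hR.reflect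
      hR.reflect).norm.div_const |z.im|
    simpa [KerrDeSitter.reflect, mul_comm] using this
  -- An increasing function with limit `0` at both endpoints is zero.
  have hb0 : ∀ x ∈ Ioo 0 (xEnd Λ a), b x = 0 := by
    intro x hx
    refine le_antisymm (ge_of_tendsto hr ?_) (le_of_tendsto hl ?_)
    · filter_upwards [Ioo_mem_nhdsGT (sub_pos.2 hx.2)] with y hy
      exact hmono hx ⟨by linarith [hx.1, hy.2], by linarith [hy.1]⟩ (by linarith [hy.2])
    · filter_upwards [Ioo_mem_nhdsGT hx.1] with y hy
      exact hmono ⟨hy.1, hy.2.trans hx.2⟩ hx hy.2.le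
  have hd0 : HasDerivAt b 0 x := (hasDerivAt_const x (0 : ℝ)).congr_of_eventuallyEq
    (Filter.eventually_of_mem (I_mem_nhds hx) hb0)
  have hsum := (hbd x hx).unique hd0
  have hp1 := sq_nonneg ‖Φ.1 x‖
  have hp2 := sq_nonneg ‖Φ.2 x‖
  constructor
  · exact norm_eq_zero.1 (pow_eq_zero_iff two_ne_zero |>.1 (by linarith))
  · exact norm_eq_zero.1 (pow_eq_zero_iff two_ne_zero |>.1 (by linarith))

theorem eq_zero_of_adjPair (hk : k ∉ Ioo (-1 : ℝ) 0) (hz : z.im ≠ 0) {F : H Λ a}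
    (h : LinearPMap.AdjPair (minOp hΛ a k) F (z • F)) : F = 0 := by
  obtain ⟨Φ, hs, e1, e2⟩ := exists_isSolution_of_adjPair hΛ h
  have h0 := fun x (hx : x ∈ I Λ a) => hs.eq_zero_of_memLp hΛ hk hz
    ((memLp_congr_ae e1).1 (memLp_fst F)) ((memLp_congr_ae e2).1 (memLp_snd F)) hx
  have hmem : ∀ᵐ x ∂(mu Λ a), x ∈ I Λ a := ae_restrict_mem (I Λ a).2.measurableSet
  refine WithLp.ofLp_injective 2 (Prod.ext ((Lp.eq_zero_iff_ae_eq_zero).2 ?_)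
    ((Lp.eq_zero_iff_ae_eq_zero).2 ?_))
  · filter_upwards [e1, hmem] with x hx hxI
    exact hx.trans (h0 x hxI).1
  · filter_upwards [e2, hmem] with x hx hxI
    exact hx.trans (h0 x hxI).2

theorem isSelfAdjoint_Au (a : ℝ) (hk : k ∉ Ioo (-1 : ℝ) 0) : IsSelfAdjoint (Au hΛ a k) :=
  LinearPMap.isSelfAdjoint_closure (dense_minOp_domain hΛ a k) (minOp_symmetric hΛ a k)
    (fun _ h => eq_zero_of_adjPair hΛ hk (by simp) h)
    fun _ h => eq_zero_of_adjPair hΛ hk (by simp) h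

theorem isSelfAdjoint_Au_iff (a k : ℝ) : IsSelfAdjoint (Au hΛ a k) ↔ k ∉ Ioo (-1 : ℝ) 0 :=
  ⟨fun h hk => not_isSelfAdjoint hΛ a hk h, isSelfAdjoint_Au hΛ a⟩

theorem intCast_notMem_Ioo (k : ℤ) : (k : ℝ) ∉ Ioo (-1 : ℝ) 0 := by
  rintro ⟨h1, h2⟩
  have h3 : (-1 : ℤ) < k := by exact_mod_cast h1
  have h4 : k < 0 := by exact_mod_cast h2
  omega

end KerrDeSitter

theorem mainTheorem2 (Λ a : ℝ) (hΛ : 0 ≤ Λ) :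
    (∀ k : ℝ,
      Dense ((KerrDeSitter.minOp hΛ a k).domain : Set (KerrDeSitter.H Λ a)) ∧
      (KerrDeSitter.minOp hΛ a k).IsClosable ∧
      (IsSelfAdjoint (KerrDeSitter.Au hΛ a k) ↔ k ∉ Set.Ioo (-1 : ℝ) 0) ∧
      (k ∉ Set.Ioo (-1 : ℝ) 0 →
        KerrDeSitter.IsLimitPoint Λ a k (KerrDeSitter.LiesLeft Λ a) ∧
        KerrDeSitter.IsLimitPoint Λ a k (KerrDeSitter.LiesRight Λ a)) ∧
      (k ∈ Set.Ioo (-1 : ℝ) 0 →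
        KerrDeSitter.IsLimitCircle Λ a k (KerrDeSitter.LiesLeft Λ a) ∧
        KerrDeSitter.IsLimitCircle Λ a k (KerrDeSitter.LiesRight Λ a))) ∧
    (∀ k : ℤ, IsSelfAdjoint (KerrDeSitter.Au hΛ a k)) := by
  refine ⟨fun k => ⟨KerrDeSitter.dense_minOp_domain hΛ a k, KerrDeSitter.isClosable_minOp hΛ a k,
    KerrDeSitter.isSelfAdjoint_Au_iff hΛ a k, fun hk => ?_, fun hk => ?_⟩, fun k =>
    KerrDeSitter.isSelfAdjoint_Au hΛ a (KerrDeSitter.intCast_notMem_Ioo k)⟩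
  · have h := KerrDeSitter.isLimitPoint_left hΛ (a := a) hk
    exact ⟨h, h.right hΛ⟩
  · have h := KerrDeSitter.isLimitCircle_left hΛ (a := a) hk
    exact ⟨h, h.right hΛ⟩
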